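/- **Setting.** Let $T\ge\delta>0$ and $0=t_0<t_1<\dots<t_N=T-\delta$. Let $(X_s)_{s\in[0,T]}$ be a solution in $\mathbb R^d$, with continuous paths, of the Itô SDE $dX_s=f(s,X_s)\,ds+g(s)\,dW_s$, $X_0\sim q_0$ (in the weak sense, i.e. a solution of the associated martingale problem), where $q_0$ is any probability measure, $f$ and $\nabla f$ are continuous on $[0,T]\times\mathbb R^d$, and $g:[0,T]\to\mathbb R$ is continuous. Assume that for $0<s\le T$ the law of $X_s$ has a positive density $q_s(x)=q(s,x)$, twice differentiable in $x$, with $q,\nabla q,\nabla^2q$ continuous in $(s,x)\in(0,T]\times\mathbb R^d$. *True reverse process.* $(Y_t)_{t\in[0,T-\delta]}$ is a process with $Y_0\sim q_T$ that almost surely solves $$\frac{dY_t}{dt}=-\Big(f(T-t,Y_t)-\tfrac12 g(T-t)^2\nabla\log q_{T-t}(Y_t)\Big),\qquad t\in[0,T-\delta].$$ *Sampling process.* For each $k<N$ let $F_t=F_{t_k\to t}:\mathbb R^d\to\mathbb R^d$, $t\in[t_k,t_{k+1}]$, be the interpolation operator of the $k$-th step: $F_{t_k}=\mathrm{id}$;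 $t\mapsto F_t(x)$ is differentiable; its velocity $\frac{\partial F}{\partial t}(t,x)$ is differentiable in $x$, and the velocity and its Jacobian $\nabla\big[\frac{\partial F}{\partial t}\big](t,x)$ are continuous in $(t,x)$ on $[t_k,t_{k+1}]\times\mathbb R^d$; each $F_t$ is bijective with differentiable inverse $F_t^{-1}$. Let $\hat Y_{t_0}\sim\pi_d$, where $\pi_d$ is any probability measure (e.g. a Gaussian), and $\hat Y_{t_{k+1}}=F_{t_k\to t_{k+1}}(\hat Y_{t_k})$ almost surely. *Error operators.* For $t\in[t_k,t_{k+1}]$ put $$\Phi_k(t,x)=\frac{\partial F}{\partial t}(t,x)+f\big(T-t,F_t(x)\big)-\tfrac12 g(T-t)^2\,\nabla\log q_{T-t_k}(x),$$ $$\Psi_k(t,x)=\nabla\Big[\frac{\partial F}{\partial t}\Big](t,x)+\nabla_x\big[f\big(T-t,F_t(x)\big)\big]-\tfrac12 g(T-t)^2\,\nabla^2\log q_{T-t_k}(x).$$ Write $p_Z$ for the Lebesgue density of the law of $Z$, and $\mathrm{TV}(\mu,\nu)=\sup_A|\mu(A)-\nu(A)|$. **Theorem.** With $z=F_t^{-1}(x)$,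 the following holds in $[0,\infty]$: $$\begin{aligned} \mathrm{TV}(Y_{T-\delta},\hat Y_{t_N})\le{}&\mathrm{TV}(q_T,\pi_d)+\sum_{k=0}^{N-1}\int_{t_k}^{t_{k+1}}\Bigg[\sqrt{\mathbb E\|\Phi_k(t,Y_{t_k})\|^2}\,\sqrt{\int\Big\|\frac{\nabla\log q_{T-t}(x)\,p_{Y_t}(x)}{p_{F_t(Y_{t_k})}(x)}\Big\|^2p_{F_t(Y_{t_k})}(x)\,dx}\\ &+\sqrt{\mathbb E\big[(\operatorname{tr}\Psi_k(t,Y_{t_k}))^2\big]}\,\sqrt{\int\Big(\frac{p_{Y_t}(x)}{p_{F_t(Y_{t_k})}(x)}\Big)^2p_{F_t(Y_{t_k})}(x)\,dx}\\ &+\tfrac12 g(T-t)^2\int\Big|\big(\nabla\log q_{T-t_k}(z)-\nabla\log q_{T-t}(x)\big)\cdot\nabla\log q_{T-t}(x)\Big|\,q_{T-t}(x)\,dx\\ &+\tfrac12 g(T-t)^2\int\Big|\operatorname{tr}\big(\nabla^2\log q_{T-t_k}(z)-\nabla^2\log q_{T-t}(x)\big)\Big|\,q_{T-t}(x)\,dx\\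 &+\sup_x\bigg|\operatorname{tr}\bigg(\Big(\nabla\Big[\frac{\partial F}{\partial t}\Big](t,z)+\nabla_z\big[f(T-t,F_t(z))\big]\Big)\big(\nabla F_t^{-1}(x)-I\big)\bigg)\bigg|\Bigg]dt . \end{aligned}$$ -/

import Mathlib

open MeasureTheory ProbabilityTheory Set
open scoped ENNReal

noncomputable section

namespace DetSampler

/-- The state space `ℝ^d` with its Euclidean norm. -/
abbrev Space (d : ℕ) := EuclideanSpace ℝ (Fin d)

variable {d : ℕ}

/-- Trace of a linear endomorphism (a `d × d` matrix). -/
def tr (A : Space d →L[ℝ] Space d) : ℝ :=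
  LinearMap.trace ℝ (Space d) (A : Space d →ₗ[ℝ] Space d)

/-- Total variation distance `sup_A |μ(A) - ν(A)|`, the supremum being over measurable sets
(for laws with densities `p`, `q` this is `(1/2) ∫ |p - q|`). -/
def tvDist {α : Type*} [MeasurableSpace α] (μ ν : Measure α) : ℝ≥0∞ :=
  ⨆ (A : Set α) (_ : MeasurableSet A), ENNReal.ofReal |μ.real A - ν.real A|

/-! ### The forward process -/

/-- The generator at time `s` of `dX = f(s, X) ds + g(s) dW`:
`(L_s φ)(x) = ∇φ(x) · f(s,x) + (1/2) g(s)² Δφ(x)`. -/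
def generator (f : ℝ → Space d → Space d) (g : ℝ → ℝ) (s : ℝ) (φ : Space d → ℝ)
    (x : Space d) : ℝ :=
  fderiv ℝ φ x (f s x) + g s ^ 2 / 2 * Laplacian.laplacian φ x

/-- `X` is a (weak) solution on `[0, T]` of the Itô equation `dX = f(s, X) ds + g(s) dW`,
`X_0 ∼ q₀`, in the sense of the martingale problem: `X` is adapted with continuous paths and,
for every smooth compactly supported test function `φ`, the process
`φ(X_s) - ∫_0^s (L_u φ)(X_u) du` is a martingale. -/
structure IsForwardProcess {Ω : Type*} {mΩ : MeasurableSpace Ω} (T : ℝ)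
    (f : ℝ → Space d → Space d) (g : ℝ → ℝ) (q₀ : Measure (Space d)) (P : Measure Ω)
    (ℱ : Filtration (Icc (0 : ℝ) T) mΩ) (X : ℝ → Ω → Space d) : Prop where
  adapted : StronglyAdapted ℱ (fun (s : Icc (0 : ℝ) T) ω => X s ω)
  continuous_paths : ∀ ω, ContinuousOn (fun s => X s ω) (Icc 0 T)
  initial : HasLaw (X 0) q₀ P
  martingale : ∀ φ : Space d → ℝ, ContDiff ℝ (⊤ : ℕ∞) φ → HasCompactSupport φ →
    Martingale (fun (s : Icc (0 : ℝ) T) ω =>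
      φ (X s ω) - ∫ u in (0 : ℝ)..s, generator f g u φ (X u ω)) ℱ P

/-- Regularity of the coefficients on `[0, T]`: the drift is continuous in `(s, x)` and
continuously differentiable in `x`, and the diffusion coefficient is continuous. -/
structure RegularCoefficients (T : ℝ) (f : ℝ → Space d → Space d) (g : ℝ → ℝ) : Prop where
  drift_differentiable : ∀ s ∈ Icc 0 T, Differentiable ℝ (f s)
  drift_continuous : ContinuousOn (fun p : ℝ × Space d => f p.1 p.2) (Icc 0 T ×ˢ univ)
  drift_deriv_continuous :
    ContinuousOn (fun p : ℝ × Space d => fderiv ℝ (f p.1) p.2) (Icc 0 T ×ˢ univ)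
  diffusion_continuous : ContinuousOn g (Icc 0 T)

/-- For `0 < s ≤ T` the function `q s` is the density of the law of `X_s`; it is positive and
twice differentiable in `x`, and `q`, `∇q`, `∇²q` are continuous in `(s, x)`. -/
structure IsMarginalDensity {Ω : Type*} [MeasurableSpace Ω] (T : ℝ) (P : Measure Ω)
    (X : ℝ → Ω → Space d) (q : ℝ → Space d → ℝ) : Prop where
  law : ∀ s ∈ Ioc 0 T, HasLaw (X s) (volume.withDensity fun x => ENNReal.ofReal (q s x)) P
  pos : ∀ s ∈ Ioc 0 T, ∀ x, 0 < q s x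
  contDiff : ∀ s ∈ Ioc 0 T, ContDiff ℝ 2 (q s)
  continuous : ContinuousOn (fun p : ℝ × Space d => q p.1 p.2) (Ioc 0 T ×ˢ univ)
  deriv_continuous :
    ContinuousOn (fun p : ℝ × Space d => fderiv ℝ (q p.1) p.2) (Ioc 0 T ×ˢ univ)
  deriv_two_continuous :
    ContinuousOn (fun p : ℝ × Space d => fderiv ℝ (fderiv ℝ (q p.1)) p.2) (Ioc 0 T ×ˢ univ)

/-- The score `∇ log q_s (x)`. -/
def score (q : ℝ → Space d → ℝ) (s : ℝ) (x : Space d) : Space d :=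
  gradient (fun y => Real.log (q s y)) x

/-- The Jacobian `∇² log q_s (x)` of the score. -/
def scoreJac (q : ℝ → Space d → ℝ) (s : ℝ) (x : Space d) : Space d →L[ℝ] Space d :=
  fderiv ℝ (score q s) x

/-! ### The true reverse process and the sampling process -/

/-- The drift `b(t,x) = -(f(T-t,x) - (1/2) g(T-t)² ∇ log q_{T-t}(x))` of the true reverse
process. -/
def reverseDrift (T : ℝ) (f : ℝ → Space d → Space d) (g : ℝ → ℝ) (q : ℝ → Space d → ℝ)
    (t : ℝ) (x : Space d) : Space d :=
  -(f (T - t) x - (1 / 2 * g (T - t) ^ 2) • score q (T - t) x)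

/-- `Y` solves the probability flow equation `dY = b(t, Y) dt` on `[0, τ]`, with `Y_0 ∼ q_T`. -/
structure IsReverseProcess {Ω : Type*} [MeasurableSpace Ω] (T τ : ℝ)
    (f : ℝ → Space d → Space d) (g : ℝ → ℝ) (q : ℝ → Space d → ℝ) (P : Measure Ω)
    (Y : ℝ → Ω → Space d) : Prop where
  aemeasurable : ∀ t ∈ Icc 0 τ, AEMeasurable (Y t) P
  initial : HasLaw (Y 0) (volume.withDensity fun x => ENNReal.ofReal (q T x)) P
  ode : ∀ᵐ ω ∂P, ∀ t ∈ Icc 0 τ,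
    HasDerivWithinAt (fun r => Y r ω) (reverseDrift T f g q t (Y t ω)) (Icc 0 τ) t

/-- The partial derivative `∂F/∂t (t, x)` on the time interval `[a, b]` (one-sided at the
endpoints). -/
def timeDeriv (F : ℝ → Space d → Space d) (a b t : ℝ) (x : Space d) : Space d :=
  derivWithin (fun s => F s x) (Icc a b) t

/-- `F t = F_{a → t}`, for `a ≤ t ≤ b`, is the interpolation operator of one step of a sampler:
it starts at the identity, it is differentiable in time with a velocity `∂F/∂t` that is
continuous in `(t, x)` and continuously differentiable in `x`, and each `F t` is invertible with
a differentiable inverse. -/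
structure IsInterpolation (F : ℝ → Space d → Space d) (a b : ℝ) : Prop where
  start : ∀ x, F a x = x
  time_differentiable : ∀ x, DifferentiableOn ℝ (fun t => F t x) (Icc a b)
  velocity_differentiable : ∀ t ∈ Icc a b, Differentiable ℝ (timeDeriv F a b t)
  velocity_continuous :
    ContinuousOn (fun p : ℝ × Space d => timeDeriv F a b p.1 p.2) (Icc a b ×ˢ univ)
  velocity_deriv_continuous :
    ContinuousOn (fun p : ℝ × Space d => fderiv ℝ (timeDeriv F a b p.1) p.2) (Icc a b ×ˢ univ)
  bijective : ∀ t ∈ Icc a b, Function.Bijective (F t)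
  inverse_differentiable : ∀ t ∈ Icc a b, Differentiable ℝ (Function.invFun (F t))

/-- The sampling process: `Ŷ_0 ∼ π` and `Ŷ_{t_{k+1}} = F_{t_k → t_{k+1}} (Ŷ_{t_k})`; here
`Yhat k` stands for `Ŷ_{t_k}` and `F k t` for `F_{t_k → t}`. -/
structure IsSamplingProcess {Ω : Type*} [MeasurableSpace Ω] (N : ℕ) (t : ℕ → ℝ)
    (F : ℕ → ℝ → Space d → Space d) (π : Measure (Space d)) (P : Measure Ω)
    (Yhat : ℕ → Ω → Space d) : Prop where
  initial : HasLaw (Yhat 0) π P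
  step : ∀ k < N, ∀ᵐ ω ∂P, Yhat (k + 1) ω = F k (t (k + 1)) (Yhat k ω)

/-! ### The error operators and the five error terms on a step `[a, b]`

`F` is the interpolation operator of the step and `t ∈ [a, b]`. -/

/-- The inverse map `F_t^{-1}`. -/
def inv (F : ℝ → Space d → Space d) (t : ℝ) : Space d → Space d :=
  Function.invFun (F t)

/-- `∇[∂F/∂t](t, z) + ∇_z [f(T-t, F_t(z))]`. -/
def jacSum (T : ℝ) (f : ℝ → Space d → Space d) (F : ℝ → Space d → Space d) (a b t : ℝ)
    (z : Space d) : Space d →L[ℝ] Space d :=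
  fderiv ℝ (timeDeriv F a b t) z + fderiv ℝ (fun y => f (T - t) (F t y)) z

/-- The estimation-error operator
`Φ(t, x) = ∂F/∂t(t, x) + f(T-t, F_t(x)) - (1/2) g(T-t)² ∇ log q_{T-a}(x)`. -/
def Phi (T : ℝ) (f : ℝ → Space d → Space d) (g : ℝ → ℝ) (q : ℝ → Space d → ℝ)
    (F : ℝ → Space d → Space d) (a b t : ℝ) (x : Space d) : Space d :=
  timeDeriv F a b t x + f (T - t) (F t x) - (1 / 2 * g (T - t) ^ 2) • score q (T - a) x

/-- The divergence-error operator
`Ψ(t, x) = ∇[∂F/∂t](t, x) + ∇_x [f(T-t, F_t(x))] - (1/2) g(T-t)² ∇² log q_{T-a}(x)`. -/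
def Psi (T : ℝ) (f : ℝ → Space d → Space d) (g : ℝ → ℝ) (q : ℝ → Space d → ℝ)
    (F : ℝ → Space d → Space d) (a b t : ℝ) (x : Space d) : Space d →L[ℝ] Space d :=
  jacSum T f F a b t x - (1 / 2 * g (T - t) ^ 2) • scoreJac q (T - a) x

/-- (I) Score estimation error:
`√(E ‖Φ(t, Y_a)‖²) · √(∫ ‖∇ log q_{T-t} · p_{Y_t} / p_{F_t(Y_a)}‖² p_{F_t(Y_a)} dx)`,
where `p_Z` is the Lebesgue density of the law of `Z`. -/
def scoreEstimationError {Ω : Type*} [MeasurableSpace Ω] (P : Measure Ω)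
    (Y : ℝ → Ω → Space d) (T : ℝ) (f : ℝ → Space d → Space d) (g : ℝ → ℝ)
    (q : ℝ → Space d → ℝ) (F : ℝ → Space d → Space d) (a b t : ℝ) : ℝ≥0∞ :=
  (∫⁻ ω, ‖Phi T f g q F a b t (Y a ω)‖ₑ ^ 2 ∂P) ^ (1 / 2 : ℝ) *
    (∫⁻ x, (‖score q (T - t) x‖ₑ * pdf (Y t) P volume x /
        pdf (fun ω => F t (Y a ω)) P volume x) ^ 2 *
      pdf (fun ω => F t (Y a ω)) P volume x) ^ (1 / 2 : ℝ)

/-- (II) Divergence estimation error: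
`√(E (tr Ψ(t, Y_a))²) · √(∫ (p_{Y_t} / p_{F_t(Y_a)})² p_{F_t(Y_a)} dx)`. -/
def divEstimationError {Ω : Type*} [MeasurableSpace Ω] (P : Measure Ω)
    (Y : ℝ → Ω → Space d) (T : ℝ) (f : ℝ → Space d → Space d) (g : ℝ → ℝ)
    (q : ℝ → Space d → ℝ) (F : ℝ → Space d → Space d) (a b t : ℝ) : ℝ≥0∞ :=
  (∫⁻ ω, ‖tr (Psi T f g q F a b t (Y a ω))‖ₑ ^ 2 ∂P) ^ (1 / 2 : ℝ) *
    (∫⁻ x, (pdf (Y t) P volume x / pdf (fun ω => F t (Y a ω)) P volume x) ^ 2 *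
      pdf (fun ω => F t (Y a ω)) P volume x) ^ (1 / 2 : ℝ)

/-- (III) Score discretization error, with `z = F_t^{-1}(x)`:
`(1/2) g(T-t)² ∫ |(∇ log q_{T-a}(z) - ∇ log q_{T-t}(x)) · ∇ log q_{T-t}(x)| q_{T-t}(x) dx`. -/
def scoreDiscretizationError (T : ℝ) (g : ℝ → ℝ) (q : ℝ → Space d → ℝ)
    (F : ℝ → Space d → Space d) (a t : ℝ) : ℝ≥0∞ :=
  ENNReal.ofReal (1 / 2 * g (T - t) ^ 2) *
    ∫⁻ x, ‖inner ℝ (score q (T - a) (inv F t x) - score q (T - t) x) (score q (T - t) x)‖ₑ *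
      ENNReal.ofReal (q (T - t) x)

/-- (IV) Divergence discretization error, with `z = F_t^{-1}(x)`:
`(1/2) g(T-t)² ∫ |tr (∇² log q_{T-a}(z) - ∇² log q_{T-t}(x))| q_{T-t}(x) dx`. -/
def divDiscretizationError (T : ℝ) (g : ℝ → ℝ) (q : ℝ → Space d → ℝ)
    (F : ℝ → Space d → Space d) (a t : ℝ) : ℝ≥0∞ :=
  ENNReal.ofReal (1 / 2 * g (T - t) ^ 2) *
    ∫⁻ x, ‖tr (scoreJac q (T - a) (inv F t x) - scoreJac q (T - t) x)‖ₑ *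
      ENNReal.ofReal (q (T - t) x)

/-- (V) Bias error, with `z = F_t^{-1}(x)`:
`sup_x |tr ((∇[∂F/∂t](t, z) + ∇_z [f(T-t, F_t(z))]) (∇F_t^{-1}(x) - I))|`. -/
def biasError (T : ℝ) (f : ℝ → Space d → Space d) (F : ℝ → Space d → Space d)
    (a b t : ℝ) : ℝ≥0∞ :=
  ⨆ x : Space d, ‖tr ((jacSum T f F a b t (inv F t x)).comp
    (fderiv ℝ (inv F t) x - ContinuousLinearMap.id ℝ (Space d)))‖ₑ

end DetSampler

end

open MeasureTheory ProbabilityTheory Set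
open scoped ENNReal

noncomputable section

namespace DetSampler

open Filter Topology
open scoped NNReal

variable {d : ℕ}

/-! The law of the probability flow and the law of one sampler step are compared in Lagrangian
coordinates, and the steps are then chained.

The martingale problem, taken in expectation and integrated by parts, gives the Fokker-Planck
equation for `q` (`IsForwardProcess.density_sub`). Since `div (q ∇ log q) = Δ q`, this second-order
equation, run backwards in time, is the first-order continuity equation `∂ρ/∂t = -div (ρ b)` for `ρ
t = q (T - t)` and the reverse drift `b` (`IsForwardProcess.isTransported`). That `Y t` really has
density `q (T - t)` needs an argument, because `b` has no growth bound and its flow may explode.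
Only trajectories inside a ball are followed: on their initial values the endpoint map is injective
and differentiable, with Jacobian the ratio of the two densities. The change of variables gives one
inequality between the law of `Y τ` and `ρ τ`, and two probability measures ordered in this way are
equal (`IsTransported.map_eq`).

On a step `[α, β]` the pulled-back density `r t z = ρ t (F t z) * det ∇F_t z` starts from the
density `ρ α` of `Y α`. By the continuity equation and Jacobi's formula its time derivative is the
determinant times `stepDefect`, which is `div ((û - b) ρ)` for the velocity `û` of the
interpolation. Integrating in `t` and `z` and changing variables back bounds the one-step total
variation by `∫∫ |stepDefect|` (`IsTransported.tvDist_step_le`).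

Pointwise the defect equals `q` times a sum of five terms (`stepDefect_eq`): the frozen score is
added and subtracted, and `∇F_t⁻¹` is replaced by the identity at the price of the bias term.
Cauchy-Schwarz, weighted by the density of `F_t (Y α)`, turns the first two into the estimation
errors (`lintegral_mul_le_pdf`). The triangle inequality and the fact that a common map does not
increase total variation then sum the steps. -/

/-! ### Trace and determinant -/

/-- The trace as a continuous linear functional. -/
def trL (d : ℕ) : (Space d →L[ℝ] Space d) →L[ℝ] ℝ :=
  LinearMap.toContinuousLinearMap
    ((LinearMap.trace ℝ (Space d)).comp (ContinuousLinearMap.coeLM ℝ))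

theorem continuous_tr : Continuous (tr : (Space d →L[ℝ] Space d) → ℝ) := (trL d).continuous

theorem tr_add (A B : Space d →L[ℝ] Space d) : tr (A + B) = tr A + tr B := (trL d).map_add A B

theorem tr_sub (A B : Space d →L[ℝ] Space d) : tr (A - B) = tr A - tr B := (trL d).map_sub A B

theorem tr_neg (A : Space d →L[ℝ] Space d) : tr (-A) = -tr A := (trL d).map_neg A

theorem tr_smul (c : ℝ) (A : Space d →L[ℝ] Space d) : tr (c • A) = c * tr A :=
  (trL d).map_smul c A

theorem tr_eq_sum (A : Space d →L[ℝ] Space d) :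
    tr A = ∑ i, A (EuclideanSpace.single i 1) i := by
  have h := LinearMap.trace_eq_matrix_trace ℝ (EuclideanSpace.basisFun (Fin d) ℝ).toBasis
    (A : Space d →ₗ[ℝ] Space d)
  rw [tr, h, Matrix.trace]
  simp [LinearMap.toMatrix_apply]

theorem det_eq_matrix_det (A : Space d →L[ℝ] Space d) :
    A.det = (Matrix.of fun i j => A (EuclideanSpace.single j 1) i).det := by
  rw [ContinuousLinearMap.det,
    ← LinearMap.det_toMatrix (EuclideanSpace.basisFun (Fin d) ℝ).toBasis]
  refine congrArg Matrix.det (Matrix.ext fun i j => ?_)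
  simp [LinearMap.toMatrix_apply]

theorem differentiable_det :
    Differentiable ℝ (fun A : Space d →L[ℝ] Space d => A.det) := by
  have h : (fun A : Space d →L[ℝ] Space d => A.det) = fun A =>
      ∑ σ : Equiv.Perm (Fin d), ((Equiv.Perm.sign σ : ℤ) : ℝ) *
        ∏ i, A (EuclideanSpace.single i 1) (σ i) := by
    ext A
    rw [det_eq_matrix_det, Matrix.det_apply']
    rfl
  rw [h]
  refine Differentiable.fun_sum fun σ _ => Differentiable.const_mul ?_ _
  fun_prop

/-- The polynomial `det (1 + r H)` is `1 + r tr H` plus `r ^ 2` times a polynomial; this is Jacobi's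
formula at the identity. -/
theorem hasDerivAt_det_one_add_smul (H : Space d →L[ℝ] Space d) :
    HasDerivAt (fun r : ℝ => (1 + r • H).det) (tr H) 0 := by
  set b := (EuclideanSpace.basisFun (Fin d) ℝ).toBasis
  set m := LinearMap.toMatrix b b (H : Space d →ₗ[ℝ] Space d) with hm
  have h : (fun r : ℝ => (1 + r • H).det) = fun r : ℝ => 1 + tr H * r +
      (Matrix.det (1 + (Polynomial.X : Polynomial ℝ) •
        m.map Polynomial.C)).divX.divX.eval r * r ^ 2 := by
    ext r
    rw [ContinuousLinearMap.det, ← LinearMap.det_toMatrix b]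
    have e : LinearMap.toMatrix b b ((1 + r • H : Space d →L[ℝ] Space d) : Space d →ₗ[ℝ] Space d)
        = 1 + r • m := by
      rw [hm, ← map_smul, ← LinearMap.toMatrix_one b, ← map_add]
      rfl
    rw [e, Matrix.det_one_add_smul, tr, LinearMap.trace_eq_matrix_trace ℝ b]
  rw [h]
  have h1 : HasDerivAt (fun r : ℝ => 1 + tr H * r) (tr H) 0 := by
    simpa using ((hasDerivAt_id (0 : ℝ)).const_mul (tr H)).const_add 1
  have h2 := (Polynomial.hasDerivAt (Matrix.det (1 + (Polynomial.X : Polynomial ℝ) •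
        m.map Polynomial.C)).divX.divX (0 : ℝ)).mul (hasDerivAt_pow 2 (0 : ℝ))
  exact (h1.add h2).congr_deriv (by simp)

/-- Jacobi's formula along a curve of invertible endomorphisms. -/
theorem hasDerivWithinAt_det {M : ℝ → Space d →L[ℝ] Space d} {M' B : Space d →L[ℝ] Space d}
    {s : Set ℝ} {t : ℝ} (hM : HasDerivWithinAt M M' s t) (hB : M t * B = 1) :
    HasDerivWithinAt (fun r => (M r).det) ((M t).det * tr (M' * B)) s t := by
  have hd : (M t).det * B.det = 1 := by
    have := congrArg ContinuousLinearMap.det hB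
    simpa [ContinuousLinearMap.det, ContinuousLinearMap.toLinearMap_mul, map_mul] using this
  -- The derivative at the identity exists because the determinant is polynomial; restricting to the
  -- lines `1 + r H` identifies it with the trace.
  have hf : HasFDerivAt (fun A : Space d →L[ℝ] Space d => A.det) (trL d) 1 := by
    have h := (differentiable_det (d := d) 1).hasFDerivAt
    convert h using 1
    ext H
    have h1 : HasDerivAt (fun r : ℝ => (1 : Space d →L[ℝ] Space d) + r • H) H 0 := by
      simpa using ((hasDerivAt_id (0 : ℝ)).smul_const H).const_add 1
    have h0 : HasFDerivAt (fun A : Space d →L[ℝ] Space d => A.det)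
        (fderiv ℝ (fun A : Space d →L[ℝ] Space d => A.det) 1) (1 + (0 : ℝ) • H) := by
      have e : (1 : Space d →L[ℝ] Space d) + (0 : ℝ) • H = 1 := by ext; simp
      rw [e]
      exact h
    have h2 := HasFDerivAt.comp_hasDerivAt (0 : ℝ) h0 h1
    exact (hasDerivAt_det_one_add_smul H).unique h2
  have hN : HasDerivWithinAt (fun r => M r * B) (M' * B) s t := hM.mul_const B
  have h := HasFDerivAt.comp_hasDerivWithinAt t (by rw [hB]; exact hf) hN
  have h3 := h.const_mul (M t).det
  -- The curve `M r * B` passes through `1` at `r = t`, so the formula at the identity suffices.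
  have hdet : ∀ r, (M r).det = (M t).det * (M r * B).det := fun r => by
    have h4 : (M r * B).det = (M r).det * B.det := by
      simp [ContinuousLinearMap.det, ContinuousLinearMap.toLinearMap_mul, map_mul]
    rw [h4]
    linear_combination (-(M r).det) * hd
  exact h3.congr (fun r _ => hdet r) (hdet t)

/-! ### Linear differential equations -/

section Linear

variable {G : Type*} [NormedAddCommGroup G] [NormedSpace ℝ G]

/-- The radial retraction onto the ball of radius `R`. -/
def radialRetraction (R : ℝ) (x : G) : G := (R / max R ‖x‖) • x

theorem radialRetraction_eq_self {R : ℝ} (hR : 0 < R) {x : G} (hx : ‖x‖ ≤ R) :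
    radialRetraction R x = x := by
  rw [radialRetraction, max_eq_left hx, div_self hR.ne', one_smul]

theorem norm_radialRetraction_le {R : ℝ} (hR : 0 < R) (x : G) :
    ‖radialRetraction R x‖ ≤ R ∧ ‖radialRetraction R x‖ ≤ ‖x‖ := by
  have hm : 0 < max R ‖x‖ := lt_max_of_lt_left hR
  rw [radialRetraction, norm_smul, Real.norm_of_nonneg (by positivity), div_mul_eq_mul_div]
  constructor
  · rw [div_le_iff₀ hm]
    exact mul_le_mul_of_nonneg_left (le_max_right _ _) hR.le
  · rw [div_le_iff₀ hm, mul_comm]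
    exact mul_le_mul_of_nonneg_left (le_max_left _ _) (norm_nonneg _)

/-- The constant `2` is crude, but any Lipschitz constant serves for Picard-Lindelöf. -/
theorem norm_radialRetraction_sub_le {R : ℝ} (hR : 0 < R) (x y : G) :
    ‖radialRetraction R x - radialRetraction R y‖ ≤ 2 * ‖x - y‖ := by
  have hx : 0 < max R ‖x‖ := lt_max_of_lt_left hR
  have hy : 0 < max R ‖y‖ := lt_max_of_lt_left hR
  have e : radialRetraction R x - radialRetraction R y =
      (R / max R ‖x‖) • (x - y) + (R / max R ‖x‖ - R / max R ‖y‖) • y := by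
    simp only [radialRetraction]
    module
  have h1 : ‖(R / max R ‖x‖) • (x - y)‖ ≤ ‖x - y‖ := by
    rw [norm_smul, Real.norm_of_nonneg (by positivity)]
    refine mul_le_of_le_one_left (norm_nonneg _) ?_
    rw [div_le_one hx]
    exact le_max_left _ _
  have h2 : ‖(R / max R ‖x‖ - R / max R ‖y‖) • y‖ ≤ ‖x - y‖ := by
    rw [norm_smul, div_sub_div _ _ hx.ne' hy.ne', ← mul_comm R, ← mul_sub, Real.norm_eq_abs,
      abs_div, abs_mul, abs_of_pos hR, abs_of_pos (mul_pos hx hy), div_mul_eq_mul_div,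
      div_le_iff₀ (mul_pos hx hy)]
    have h3 : |max R ‖y‖ - max R ‖x‖| ≤ ‖x - y‖ := by
      rw [max_comm R, max_comm R]
      refine (abs_max_sub_max_le_abs _ _ _).trans ?_
      rw [norm_sub_rev]
      exact abs_norm_sub_norm_le _ _
    calc R * |max R ‖y‖ - max R ‖x‖| * ‖y‖
        ≤ max R ‖x‖ * ‖x - y‖ * max R ‖y‖ := by
          gcongr
          · exact le_max_left _ _
          · exact le_max_right _ _
      _ = _ := by ring
  rw [e]
  refine (norm_add_le _ _).trans ?_
  linarith

theorem hasDerivWithinAt_Ici_of_Icc {f : ℝ → G} {f' : G} {a b t : ℝ} (ht : t ∈ Ico a b)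
    (h : HasDerivWithinAt f f' (Icc a b) t) : HasDerivWithinAt f f' (Ici t) t :=
  h.mono_of_mem_nhdsWithin (Icc_mem_nhdsGE_of_mem ht)

theorem hasDerivWithinAt_Iic_of_Icc {f : ℝ → G} {f' : G} {a b t : ℝ} (ht : t ∈ Ioc a b)
    (h : HasDerivWithinAt f f' (Icc a b) t) : HasDerivWithinAt f f' (Iic t) t :=
  h.mono_of_mem_nhdsWithin (Icc_mem_nhdsLE_of_mem ht)

/-- Global existence for a linear differential equation on a compact interval. -/
theorem exists_linear_ode_solution [CompleteSpace G] {τ : ℝ} (hτ : 0 ≤ τ) {A : ℝ → G →L[ℝ] G}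
    (hA : ContinuousOn A (Icc 0 τ)) (x₀ : G) :
    ∃ x : ℝ → G, x 0 = x₀ ∧ ∀ t ∈ Icc 0 τ, HasDerivWithinAt x (A t (x t)) (Icc 0 τ) t := by
  obtain ⟨C, hC⟩ := isCompact_Icc.exists_bound_of_continuousOn hA
  set K : ℝ≥0 := ⟨max C 0, le_max_right _ _⟩ with hK
  have hAK : ∀ t ∈ Icc 0 τ, ‖A t‖ ≤ K := fun t ht => (hC t ht).trans (le_max_left _ _)
  -- This exceeds the Grönwall bound, so a solution of the truncated equation never meets the
  -- truncation; the `+ 1` keeps `R` positive.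
  set R : ℝ := ‖x₀‖ * Real.exp (K * τ) + 1 with hR
  have hR0 : 0 < R := by positivity
  set R' : ℝ≥0 := ⟨R, hR0.le⟩
  set τ' : ℝ≥0 := ⟨τ, hτ⟩
  -- After truncation the field is bounded by `K * R` everywhere, so the existence interval is all
  -- of `[0, τ]`.
  have hpl : IsPicardLindelof (fun t x => A t (radialRetraction R x))
      (⟨0, left_mem_Icc.2 hτ⟩ : Icc 0 τ) x₀ (K * R' * τ') 0 (K * R') (K * 2) := by
    refine ⟨fun t ht => ?_, fun x _ => hA.clm_apply continuousOn_const, fun t ht x _ => ?_, ?_⟩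
    · refine LipschitzOnWith.of_dist_le_mul fun x _ y _ => ?_
      rw [dist_eq_norm, ← map_sub, dist_eq_norm]
      refine ((A t).le_opNorm _).trans ?_
      refine (mul_le_mul (hAK t ht) (norm_radialRetraction_sub_le hR0 x y) (norm_nonneg _)
        K.2).trans_eq ?_
      push_cast
      ring
    · refine ((A t).le_opNorm _).trans ?_
      exact mul_le_mul (hAK t ht) (norm_radialRetraction_le hR0 x).1 (norm_nonneg _) K.2
    · have h0 : max (τ - 0) ((0 : ℝ) - 0) = τ := by simpa using hτ
      change ((K * R' : ℝ≥0) : ℝ) * max (τ - 0) ((0 : ℝ) - 0) ≤ ((K * R' * τ' : ℝ≥0) : ℝ) - 0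
      rw [h0, sub_zero, NNReal.coe_mul (K * R') τ']
      exact le_rfl
  obtain ⟨x, hx0, hx⟩ := hpl.exists_eq_forall_mem_Icc_hasDerivWithinAt₀
  have hxc : ContinuousOn x (Icc 0 τ) := fun t ht => (hx t ht).continuousWithinAt
  have hbound : ∀ t ∈ Icc 0 τ, ‖x t‖ ≤ R := by
    intro t ht
    have h := norm_le_gronwallBound_of_norm_deriv_right_le (f := x) (δ := ‖x₀‖) (K := K) (ε := 0)
        hxc
      (fun t ht => hasDerivWithinAt_Ici_of_Icc ht (hx t (Ico_subset_Icc_self ht)))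
      (congrArg norm hx0).le (fun t ht => ?_) t ht
    · rw [gronwallBound_ε0, sub_zero] at h
      have h2 : Real.exp (K * t) ≤ Real.exp (K * τ) :=
        Real.exp_le_exp.2 (mul_le_mul_of_nonneg_left ht.2 K.2)
      have h3 := mul_le_mul_of_nonneg_left h2 (norm_nonneg x₀)
      linarith
    · refine ((A t).le_opNorm _).trans ?_
      rw [add_zero]
      exact mul_le_mul (hAK t (Ico_subset_Icc_self ht)) (norm_radialRetraction_le hR0 _).2
        (norm_nonneg _) K.2
  refine ⟨x, hx0, fun t ht => ?_⟩
  have := hx t ht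
  rwa [radialRetraction_eq_self hR0 (hbound t ht)] at this

end Linear

/-- The fundamental solution of a linear differential equation, with its inverse. -/
theorem exists_fundamental_solution {τ : ℝ} (hτ : 0 ≤ τ) {A : ℝ → Space d →L[ℝ] Space d}
    (hA : ContinuousOn A (Icc 0 τ)) :
    ∃ M B : ℝ → Space d →L[ℝ] Space d, M 0 = 1 ∧
      (∀ t ∈ Icc 0 τ, HasDerivWithinAt M (A t * M t) (Icc 0 τ) t) ∧
      ∀ t ∈ Icc 0 τ, M t * B t = 1 := by
  obtain ⟨M, hM0, hM⟩ := exists_linear_ode_solution hτ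
    (A := fun t => ContinuousLinearMap.compL ℝ (Space d) (Space d) (Space d) (A t))
    ((ContinuousLinearMap.compL ℝ (Space d) (Space d) (Space d)).continuous.comp_continuousOn hA)
    (1 : Space d →L[ℝ] Space d)
  obtain ⟨B, hB0, hB⟩ := exists_linear_ode_solution hτ
    (A := fun t => -(ContinuousLinearMap.compL ℝ (Space d) (Space d) (Space d)).flip (A t))
    ((ContinuousLinearMap.compL ℝ (Space d) (Space d) (Space d)).flip.continuous.comp_continuousOn
      hA).fun_neg (1 : Space d →L[ℝ] Space d)
  replace hM : ∀ t ∈ Icc 0 τ, HasDerivWithinAt M (A t * M t) (Icc 0 τ) t := hM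
  replace hB : ∀ t ∈ Icc 0 τ, HasDerivWithinAt B (-(B t * A t)) (Icc 0 τ) t := hB
  refine ⟨M, B, hM0, hM, fun t ht => ?_⟩
  -- With `M' = A M` and `B' = -B A` the product `B M` is constant. This gives a left inverse, which
  -- in finite dimension is also a right inverse.
  have hBM : ∀ t ∈ Icc 0 τ, HasDerivWithinAt (fun r => B r * M r) 0 (Icc 0 τ) t := by
    intro t ht
    have := (hB t ht).mul (hM t ht)
    exact this.congr_deriv (by rw [neg_mul, mul_assoc, neg_add_cancel])
  have hconst := constant_of_has_deriv_right_zero (f := fun r => B r * M r) (a := 0) (b := τ)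
    (fun t ht => (hBM t ht).continuousWithinAt)
    (fun t ht => hasDerivWithinAt_Ici_of_Icc ht (hBM t (Ico_subset_Icc_self ht))) t ht
  have h1 : B t * M t = 1 := by simpa [hM0, hB0] using hconst
  have h2 : ((B t : Space d →ₗ[ℝ] Space d)) * (M t : Space d →ₗ[ℝ] Space d) = 1 := by
    rw [← ContinuousLinearMap.toLinearMap_mul, h1]; rfl
  have h3 := mul_eq_one_comm.1 h2
  rw [← ContinuousLinearMap.toLinearMap_mul] at h3
  exact ContinuousLinearMap.coe_injective h3

/-! ### Densities transported by a vector field -/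

/-- A time-dependent vector field on `[0, τ]` that is continuous in `(t, x)` and continuously
differentiable in `x`. -/
structure IsC1Field (τ : ℝ) (b : ℝ → Space d → Space d) : Prop where
  differentiable : ∀ t ∈ Icc 0 τ, Differentiable ℝ (b t)
  continuousOn : ContinuousOn (fun p : ℝ × Space d => b p.1 p.2) (Icc 0 τ ×ˢ univ)
  fderiv_continuousOn :
    ContinuousOn (fun p : ℝ × Space d => fderiv ℝ (b p.1) p.2) (Icc 0 τ ×ˢ univ)

/-- A positive function `ρ`, continuously differentiable in `x`, that solves the continuity equation
`∂ρ/∂t = -div (ρ b)` on `[0, τ]`. -/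
structure IsTransported (τ : ℝ) (b : ℝ → Space d → Space d) (ρ : ℝ → Space d → ℝ) : Prop where
  field : IsC1Field τ b
  pos : ∀ t ∈ Icc 0 τ, ∀ x, 0 < ρ t x
  differentiable : ∀ t ∈ Icc 0 τ, Differentiable ℝ (ρ t)
  continuousOn : ContinuousOn (fun p : ℝ × Space d => ρ p.1 p.2) (Icc 0 τ ×ˢ univ)
  fderiv_continuousOn :
    ContinuousOn (fun p : ℝ × Space d => fderiv ℝ (ρ p.1) p.2) (Icc 0 τ ×ˢ univ)
  continuity_equation : ∀ x, ∀ t ∈ Icc 0 τ, HasDerivWithinAt (fun r => ρ r x)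
    (-(ρ t x * tr (fderiv ℝ (b t) x) + fderiv ℝ (ρ t) x (b t x))) (Icc 0 τ) t

theorem IsC1Field.mono {τ σ : ℝ} {b : ℝ → Space d → Space d} (h : IsC1Field τ b) (hσ : σ ≤ τ) :
    IsC1Field σ b where
  differentiable t ht := h.differentiable t (Icc_subset_Icc_right hσ ht)
  continuousOn := h.continuousOn.mono (prod_mono (Icc_subset_Icc_right hσ) subset_rfl)
  fderiv_continuousOn := h.fderiv_continuousOn.mono (prod_mono (Icc_subset_Icc_right hσ) subset_rfl)

namespace IsTransported

variable {τ : ℝ} {b : ℝ → Space d → Space d} {ρ : ℝ → Space d → ℝ}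

theorem mono {σ : ℝ} (h : IsTransported τ b ρ) (hσ : σ ≤ τ) : IsTransported σ b ρ where
  field := h.field.mono hσ
  pos t ht := h.pos t (Icc_subset_Icc_right hσ ht)
  differentiable t ht := h.differentiable t (Icc_subset_Icc_right hσ ht)
  continuousOn := h.continuousOn.mono (prod_mono (Icc_subset_Icc_right hσ) subset_rfl)
  fderiv_continuousOn := h.fderiv_continuousOn.mono (prod_mono (Icc_subset_Icc_right hσ) subset_rfl)
  continuity_equation x t ht :=
    (h.continuity_equation x t (Icc_subset_Icc_right hσ ht)).mono (Icc_subset_Icc_right hσ)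

/-- Chain rule for a transported density along a curve. -/
theorem hasDerivAt_comp (h : IsTransported τ b ρ) {t : ℝ} (ht : t ∈ Ioo 0 τ) {y : ℝ → Space d}
    {v : Space d} (hy : HasDerivAt y v t) :
    HasDerivAt (fun r => ρ r (y r))
      (-(ρ t (y t) * tr (fderiv ℝ (b t) (y t)) + fderiv ℝ (ρ t) (y t) (b t (y t))) +
        fderiv ℝ (ρ t) (y t) v) t := by
  set G : ℝ → Space d → ℝ := fun t x =>
    -(ρ t x * tr (fderiv ℝ (b t) x) + fderiv ℝ (ρ t) x (b t x)) with hG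
  have hnhds : Icc 0 τ ×ˢ (univ : Set (Space d)) ∈ 𝓝 (t, y t) :=
    prod_mem_nhds (Icc_mem_nhds ht.1 ht.2) univ_mem
  have hnhds' : Ioo 0 τ ×ˢ (univ : Set (Space d)) ∈ 𝓝 (t, y t) :=
    prod_mem_nhds (Ioo_mem_nhds ht.1 ht.2) univ_mem
  have hGc : ContinuousOn (fun p : ℝ × Space d => G p.1 p.2) (Icc 0 τ ×ˢ univ) :=
    ((h.continuousOn.mul (continuous_tr.comp_continuousOn h.field.fderiv_continuousOn)).add
      (h.fderiv_continuousOn.clm_apply h.field.continuousOn)).neg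
  -- Joint differentiability follows from continuity of the two partial derivatives; the one in time
  -- is continuous because the continuity equation expresses it by continuous data.
  have key := hasStrictFDerivAt_uncurry_coprod (𝕜 := ℝ) (u := (t, y t)) (f := ρ)
    (f₁ := fun s x => ContinuousLinearMap.toSpanSingleton ℝ (G s x))
    (f₂ := fun s x => fderiv ℝ (ρ s) x) ?_ ?_ ?_ ?_
  · have h2 := key.hasFDerivAt.comp_hasDerivAt t ((hasDerivAt_id t).prodMk hy)
    refine h2.congr_deriv ?_
    simp [Function.HasUncurry.uncurry, hG]
  · filter_upwards [hnhds'] with p hp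
    exact ((h.continuity_equation p.2 p.1 (Ioo_subset_Icc_self hp.1)).hasDerivAt
      (Icc_mem_nhds hp.1.1 hp.1.2)).hasFDerivAt
  · filter_upwards [hnhds] with p hp
    exact (h.differentiable p.1 hp.1 p.2).hasFDerivAt
  · exact ((ContinuousLinearMap.toSpanSingletonCLE (𝕜 := ℝ) (E := ℝ)).continuous.comp_continuousOn
      hGc).continuousAt hnhds
  · exact h.fderiv_continuousOn.continuousAt hnhds

/-- Derivative of a transported density in moving coordinates. -/
theorem hasDerivAt_mul_det (h : IsTransported τ b ρ) {t : ℝ} (ht : t ∈ Ioo 0 τ)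
    {y : ℝ → Space d} {v : Space d} (hy : HasDerivAt y v t) {M : ℝ → Space d →L[ℝ] Space d}
    {M' B : Space d →L[ℝ] Space d} (hM : HasDerivAt M M' t) (hB : M t * B = 1) :
    HasDerivAt (fun r => ρ r (y r) * (M r).det)
      ((M t).det * (ρ t (y t) * (tr (M' * B) - tr (fderiv ℝ (b t) (y t))) +
        fderiv ℝ (ρ t) (y t) (v - b t (y t)))) t := by
  have hd : HasDerivAt (fun r => (M r).det) ((M t).det * tr (M' * B)) t := by
    rw [← hasDerivWithinAt_univ] at hM ⊢
    exact hasDerivWithinAt_det hM hB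
  refine ((h.hasDerivAt_comp ht hy).mul hd).congr_deriv ?_
  rw [map_sub]
  ring

end IsTransported

/-! ### Bounded solutions of a differential equation and their dependence on the initial value -/

/-- A solution on `[0, τ]` of `c' = b(t, c)` that stays in the ball of radius `R`. -/
structure IsSolution (τ : ℝ) (b : ℝ → Space d → Space d) (R : ℝ) (c : ℝ → Space d) : Prop where
  hasDerivWithinAt : ∀ t ∈ Icc 0 τ, HasDerivWithinAt c (b t (c t)) (Icc 0 τ) t
  norm_le : ∀ t ∈ Icc 0 τ, ‖c t‖ ≤ R

section Flow

variable {τ : ℝ} {b : ℝ → Space d → Space d}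

/-- The constant depends on the ball, since no growth condition is available; the flow estimates are
therefore confined to solutions in a common ball. -/
theorem IsC1Field.exists_bound (hb : IsC1Field τ b) (R : ℝ) :
    ∃ K : ℝ≥0, ∀ t ∈ Icc 0 τ, ∀ x ∈ Metric.closedBall (0 : Space d) R,
      ‖b t x‖ ≤ K ∧ ‖fderiv ℝ (b t) x‖ ≤ K := by
  have hc : IsCompact (Icc 0 τ ×ˢ Metric.closedBall (0 : Space d) R) :=
    isCompact_Icc.prod (isCompact_closedBall _ _)
  have hs : Icc 0 τ ×ˢ Metric.closedBall (0 : Space d) R ⊆ Icc 0 τ ×ˢ univ :=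
    prod_mono subset_rfl (subset_univ _)
  obtain ⟨C₁, h₁⟩ := hc.exists_bound_of_continuousOn (hb.continuousOn.mono hs)
  obtain ⟨C₂, h₂⟩ := hc.exists_bound_of_continuousOn (hb.fderiv_continuousOn.mono hs)
  refine ⟨⟨max (max C₁ C₂) 0, le_max_right _ _⟩, fun t ht x hx => ⟨?_, ?_⟩⟩
  · exact (h₁ (t, x) ⟨ht, hx⟩).trans ((le_max_left _ _).trans (le_max_left _ _))
  · exact (h₂ (t, x) ⟨ht, hx⟩).trans ((le_max_right _ _).trans (le_max_left _ _))

theorem IsC1Field.exists_lipschitzOnWith (hb : IsC1Field τ b) (R : ℝ) :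
    ∃ K : ℝ≥0, ∀ t ∈ Icc 0 τ, LipschitzOnWith K (b t) (Metric.closedBall 0 R) := by
  obtain ⟨K, hK⟩ := hb.exists_bound R
  refine ⟨K, fun t ht => ?_⟩
  exact (convex_closedBall _ _).lipschitzOnWith_of_nnnorm_fderiv_le
    (fun x _ => hb.differentiable t ht x) (fun x hx => (hK t ht x hx).2)

namespace IsSolution

variable {R : ℝ} {c c' : ℝ → Space d}

theorem mono {R' : ℝ} (h : IsSolution τ b R c) (hR : R ≤ R') : IsSolution τ b R' c :=
  ⟨h.hasDerivWithinAt, fun t ht => (h.norm_le t ht).trans hR⟩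

theorem continuousOn (h : IsSolution τ b R c) : ContinuousOn c (Icc 0 τ) :=
  fun t ht => (h.hasDerivWithinAt t ht).continuousWithinAt

theorem mem_closedBall (h : IsSolution τ b R c) {t : ℝ} (ht : t ∈ Icc 0 τ) :
    c t ∈ Metric.closedBall (0 : Space d) R := mem_closedBall_zero_iff.2 (h.norm_le t ht)

theorem dist_le {K : ℝ≥0} (hK : ∀ t ∈ Icc 0 τ, LipschitzOnWith K (b t) (Metric.closedBall 0 R))
    (h : IsSolution τ b R c) (h' : IsSolution τ b R c') {t : ℝ} (ht : t ∈ Icc 0 τ) :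
    dist (c t) (c' t) ≤ dist (c 0) (c' 0) * Real.exp (K * τ) := by
  refine (dist_le_of_trajectories_ODE_of_mem (fun t ht => hK t (Ico_subset_Icc_self ht))
    h.continuousOn (fun t ht => hasDerivWithinAt_Ici_of_Icc ht
      (h.hasDerivWithinAt t (Ico_subset_Icc_self ht)))
    (fun t ht => h.mem_closedBall (Ico_subset_Icc_self ht))
    h'.continuousOn (fun t ht => hasDerivWithinAt_Ici_of_Icc ht
      (h'.hasDerivWithinAt t (Ico_subset_Icc_self ht)))
    (fun t ht => h'.mem_closedBall (Ico_subset_Icc_self ht)) le_rfl t ht).trans ?_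
  gcongr
  linarith [ht.2]

theorem eq_of_initial_eq (hb : IsC1Field τ b) (h : IsSolution τ b R c)
    (h' : IsSolution τ b R c') (h0 : c 0 = c' 0) {t : ℝ} (ht : t ∈ Icc 0 τ) : c t = c' t := by
  obtain ⟨K, hK⟩ := hb.exists_lipschitzOnWith R
  have := dist_le hK h h' ht
  rw [h0, dist_self, zero_mul] at this
  exact dist_le_zero.1 this

/-- Uniqueness backwards in time: it makes the endpoint map injective for the change of variables.
-/
theorem initial_eq_of_eq (hτ : 0 ≤ τ) (hb : IsC1Field τ b) (h : IsSolution τ b R c)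
    (h' : IsSolution τ b R c') (h0 : c τ = c' τ) : c 0 = c' 0 := by
  obtain ⟨K, hK⟩ := hb.exists_lipschitzOnWith R
  exact ODE_solution_unique_of_mem_Icc_left (fun t ht => hK t (Ioc_subset_Icc_self ht))
    h.continuousOn (fun t ht => hasDerivWithinAt_Iic_of_Icc ht
      (h.hasDerivWithinAt t (Ioc_subset_Icc_self ht)))
    (fun t ht => h.mem_closedBall (Ioc_subset_Icc_self ht))
    h'.continuousOn (fun t ht => hasDerivWithinAt_Iic_of_Icc ht
      (h'.hasDerivWithinAt t (Ioc_subset_Icc_self ht)))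
    (fun t ht => h'.mem_closedBall (Ioc_subset_Icc_self ht)) h0 (left_mem_Icc.2 hτ)

/-- The integral equation characterises solutions. -/
theorem of_integral_eq (hb : IsC1Field τ b) (hc : ContinuousOn c (Icc 0 τ))
    (hR : ∀ t ∈ Icc 0 τ, ‖c t‖ ≤ R)
    (h : ∀ t ∈ Icc 0 τ, c t = c 0 + ∫ s in (0 : ℝ)..t, b s (c s)) : IsSolution τ b R c := by
  refine ⟨fun t ht => ?_, hR⟩
  have hbc : ContinuousOn (fun s => b s (c s)) (Icc 0 τ) :=
    hb.continuousOn.comp (continuousOn_id.prodMk hc) (fun s hs => ⟨hs, mem_univ _⟩)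
  have hbt : ContinuousOn (fun p : ℝ × Space d => b p.1 p.2) (Icc 0 τ ×ˢ univ) := hb.continuousOn
  have := ODE.hasDerivWithinAt_picard_Icc (f := b) (u := univ) (left_mem_Icc.2 (ht.1.trans ht.2))
    hbt hc (fun _ _ => mem_univ _) (c 0) ht
  exact this.congr_of_mem (fun s hs => h s hs) ht

theorem integral_eq (hb : IsC1Field τ b) (h : IsSolution τ b R c) {t : ℝ} (ht : t ∈ Icc 0 τ) :
    c t = c 0 + ∫ s in (0 : ℝ)..t, b s (c s) := by
  have hbc : ContinuousOn (fun s => b s (c s)) (Icc 0 τ) :=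
    hb.continuousOn.comp (continuousOn_id.prodMk h.continuousOn) (fun s hs => ⟨hs, mem_univ _⟩)
  have hsub : Icc 0 t ⊆ Icc 0 τ := Icc_subset_Icc_right ht.2
  rw [intervalIntegral.integral_eq_sub_of_hasDerivAt_of_le ht.1 (h.continuousOn.mono hsub)
    (fun s hs => (h.hasDerivWithinAt s (hsub (Ioo_subset_Icc_self hs))).hasDerivAt
      (Icc_mem_nhds hs.1 (hs.2.trans_le ht.2)))
    ((hbc.mono hsub).intervalIntegrable_of_Icc ht.1), add_sub_cancel]

end IsSolution

/-- The initial values of solutions staying in a given ball form a closed set. -/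
theorem isClosed_initial (hτ : 0 ≤ τ) (hb : IsC1Field τ b) (R : ℝ) :
    IsClosed {y | ∃ c, IsSolution τ b R c ∧ c 0 = y} := by
  obtain ⟨K, hK⟩ := hb.exists_lipschitzOnWith R
  obtain ⟨C, hC⟩ := hb.exists_bound R
  refine IsSeqClosed.isClosed fun y y₀ hy hlim => ?_
  choose c hc hc0 using hy
  -- Lipschitz dependence on the initial value makes the solutions converge at every time; the limit
  -- solves the integral equation by dominated convergence.
  have hcau : ∀ t ∈ Icc 0 τ, CauchySeq fun n => c n t := by
    intro t ht
    rw [Metric.cauchySeq_iff]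
    intro ε hε
    obtain ⟨N, hN⟩ := Metric.cauchySeq_iff.1 hlim.cauchySeq (ε / Real.exp (K * τ)) (by positivity)
    refine ⟨N, fun m hm n hn => ?_⟩
    refine ((hc m).dist_le hK (hc n) ht).trans_lt ?_
    rw [hc0, hc0]
    exact (lt_div_iff₀ (Real.exp_pos _)).1 (hN m hm n hn)
  have hex : ∀ t, ∃ x, t ∈ Icc 0 τ → Tendsto (fun n => c n t) atTop (𝓝 x) := by
    intro t
    by_cases ht : t ∈ Icc 0 τ
    · obtain ⟨x, hx⟩ := cauchySeq_tendsto_of_complete (hcau t ht)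
      exact ⟨x, fun _ => hx⟩
    · exact ⟨0, fun h => absurd h ht⟩
  choose e he using hex
  have h0 : e 0 = y₀ := by
    refine tendsto_nhds_unique (he 0 (left_mem_Icc.2 hτ)) ?_
    simpa only [hc0] using hlim
  have heR : ∀ t ∈ Icc 0 τ, ‖e t‖ ≤ R := fun t ht =>
    le_of_tendsto (he t ht).norm (Eventually.of_forall fun n => (hc n).norm_le t ht)
  have hlip : LipschitzOnWith C e (Icc 0 τ) := by
    refine LipschitzOnWith.of_dist_le_mul fun s hs t ht => ?_
    refine le_of_tendsto ((he s hs).dist (he t ht)) (Eventually.of_forall fun n => ?_)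
    have := (convex_Icc (0 : ℝ) τ).norm_image_sub_le_of_norm_hasDerivWithin_le
      (hc n).hasDerivWithinAt (fun r hr => (hC r hr _ ((hc n).mem_closedBall hr)).1) ht hs
    rwa [dist_eq_norm, dist_eq_norm]
  refine ⟨e, IsSolution.of_integral_eq hb hlip.continuousOn heR fun t ht => ?_, h0⟩
  have hsub : Set.uIoc 0 t ⊆ Icc 0 τ := by
    rw [uIoc_of_le ht.1]
    exact fun s hs => ⟨hs.1.le, hs.2.trans ht.2⟩
  refine tendsto_nhds_unique (he t ht) ?_
  have h1 : Tendsto (fun n => c n 0 + ∫ s in (0 : ℝ)..t, b s (c n s)) atTop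
      (𝓝 (e 0 + ∫ s in (0 : ℝ)..t, b s (e s))) := by
    refine (he 0 (left_mem_Icc.2 hτ)).add ?_
    refine intervalIntegral.tendsto_integral_filter_of_dominated_convergence (fun _ => (C : ℝ))
      (Eventually.of_forall fun n => ?_) (Eventually.of_forall fun n => ?_) (by simp) ?_
    · have hbc : ContinuousOn (fun s => b s (c n s)) (Icc 0 τ) :=
        hb.continuousOn.comp (continuousOn_id.prodMk (hc n).continuousOn)
          (fun s hs => ⟨hs, mem_univ _⟩)
      exact (hbc.aestronglyMeasurable measurableSet_Icc).mono_measure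
          (Measure.restrict_mono_set _ hsub)
    · exact Eventually.of_forall fun s hs => (hC s (hsub hs) _ ((hc n).mem_closedBall (hsub hs))).1
    · exact Eventually.of_forall fun s hs =>
        ((hb.differentiable s (hsub hs)).continuous.tendsto _).comp (he s (hsub hs))
  refine h1.congr fun n => ?_
  exact ((hc n).integral_eq hb ht).symm

/-- First order expansion of a solution in the initial value, along bounded solutions. -/
theorem IsSolution.exists_linearization (hτ : 0 ≤ τ) (hb : IsC1Field τ b) {R : ℝ}
    {c : ℝ → Space d} (h : IsSolution τ b R c) {M : ℝ → Space d →L[ℝ] Space d} (hM0 : M 0 = 1)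
    (hM : ∀ t ∈ Icc 0 τ, HasDerivWithinAt M (fderiv ℝ (b t) (c t) * M t) (Icc 0 τ) t)
    {ε : ℝ} (hε : 0 < ε) :
    ∃ δ > 0, ∀ c', IsSolution τ b R c' → dist (c' 0) (c 0) < δ →
      ‖c' τ - c τ - M τ (c' 0 - c 0)‖ ≤ ε * ‖c' 0 - c 0‖ := by
  obtain ⟨K, hK⟩ := hb.exists_lipschitzOnWith R
  obtain ⟨C, hC⟩ := hb.exists_bound R
  -- The response at time `τ` to a unit forcing from zero initial error; by `hgron` the Grönwall
  -- bound is linear in the forcing.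
  set g := gronwallBound 0 C 1 τ with hg
  have hgron : ∀ η : ℝ, gronwallBound 0 C η τ = η * g := by
    intro η
    by_cases hC0 : (C : ℝ) = 0
    · rw [hg, hC0, gronwallBound_K0, gronwallBound_K0]; simp
    · rw [hg, gronwallBound_of_K_ne_0 hC0, gronwallBound_of_K_ne_0 hC0]
      simp only [zero_mul, zero_add]
      ring
  have hg0 : 0 ≤ g := by
    have := gronwallBound_mono (δ := 0) (K := C) (ε := 1) le_rfl zero_le_one C.2 hτ
    rwa [gronwallBound_x0] at this
  set E := Real.exp (K * τ) with hE
  have hE0 : 0 < E := Real.exp_pos _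
  -- Chosen so that `η * E * g ≤ ε`; the `+ 1` avoids dividing by a vanishing `g`.
  set η := ε / (E * (g + 1)) with hη
  have hη0 : 0 < η := by positivity
  have huc : UniformContinuousOn (fun p : ℝ × Space d => fderiv ℝ (b p.1) p.2)
      (Icc 0 τ ×ˢ Metric.closedBall (0 : Space d) R) :=
    (isCompact_Icc.prod (isCompact_closedBall _ _)).uniformContinuousOn_of_continuous
      (hb.fderiv_continuousOn.mono (prod_mono subset_rfl (subset_univ _)))
  obtain ⟨δ, hδ, hδη⟩ := Metric.uniformContinuousOn_iff.1 huc η hη0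
  refine ⟨δ / E, by positivity, fun c' h' hdist => ?_⟩
  have hclose : ∀ t ∈ Icc 0 τ, ‖c' t - c t‖ ≤ ‖c' 0 - c 0‖ * E := fun t ht => by
    simpa only [dist_eq_norm] using h'.dist_le hK h ht
  have hclose' : ∀ t ∈ Icc 0 τ, ‖c' t - c t‖ < δ := fun t ht => by
    refine (hclose t ht).trans_lt ?_
    rwa [← dist_eq_norm, ← lt_div_iff₀ hE0]
  -- Mean value inequality on the segment between the trajectories: it stays in the ball by
  -- convexity, where the Jacobian oscillates by less than `η`.
  have hbr : ∀ t ∈ Icc 0 τ, ‖b t (c' t) - b t (c t) - fderiv ℝ (b t) (c t) (c' t - c t)‖ ≤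
      η * (‖c' 0 - c 0‖ * E) := by
    intro t ht
    refine le_trans ?_ (mul_le_mul_of_nonneg_left (hclose t ht) hη0.le)
    refine (convex_segment (c t) (c' t)).norm_image_sub_le_of_norm_hasFDerivWithin_le'
      (f' := fderiv ℝ (b t))
      (fun z _ => (hb.differentiable t ht z).hasFDerivAt.hasFDerivWithinAt) (fun z hz => ?_)
      (left_mem_segment _ _ _) (right_mem_segment _ _ _)
    have hzb : z ∈ Metric.closedBall (0 : Space d) R :=
      (convex_closedBall _ _).segment_subset (h.mem_closedBall ht) (h'.mem_closedBall ht) hz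
    have hzd : dist z (c t) < δ := by
      rw [dist_eq_norm]
      exact (norm_sub_le_of_mem_segment hz).trans_lt (hclose' t ht)
    have := hδη (t, z) ⟨ht, hzb⟩ (t, c t) ⟨ht, h.mem_closedBall ht⟩ (by
      simpa [Prod.dist_eq, hδ] using hzd)
    rw [dist_eq_norm] at this
    exact this.le
  -- The linearization error starts at zero and solves the linearized equation forced by the Taylor
  -- remainder, so Grönwall applies.
  set e : ℝ → Space d := fun t => c' t - c t - M t (c' 0 - c 0) with he
  have hed : ∀ t ∈ Icc 0 τ, HasDerivWithinAt e
      (b t (c' t) - b t (c t) - (fderiv ℝ (b t) (c t) * M t) (c' 0 - c 0)) (Icc 0 τ) t := by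
    intro t ht
    have h1 := (hM t ht).clm_apply (hasDerivWithinAt_const t (Icc 0 τ) (c' 0 - c 0))
    simp only [map_zero, add_zero] at h1
    exact ((h'.hasDerivWithinAt t ht).sub (h.hasDerivWithinAt t ht)).sub h1
  have hfin := norm_le_gronwallBound_of_norm_deriv_right_le (f := e) (δ := 0) (K := C)
    (ε := η * (‖c' 0 - c 0‖ * E)) (a := 0) (b := τ)
    (fun t ht => (hed t ht).continuousWithinAt)
    (fun t ht => hasDerivWithinAt_Ici_of_Icc ht (hed t (Ico_subset_Icc_self ht)))
    (by simp [he, hM0]) (fun t ht => ?_) τ (right_mem_Icc.2 hτ)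
  · rw [sub_zero, hgron] at hfin
    refine hfin.trans ?_
    have h3 : η * E * g ≤ ε := by
      rw [hη, div_mul_eq_mul_div, div_mul_eq_mul_div, div_le_iff₀ (by positivity)]
      nlinarith [mul_pos hε hE0]
    calc η * (‖c' 0 - c 0‖ * E) * g = η * E * g * ‖c' 0 - c 0‖ := by ring
      _ ≤ _ := mul_le_mul_of_nonneg_right h3 (norm_nonneg _)
  · have ht' := Ico_subset_Icc_self ht
    have e1 : b t (c' t) - b t (c t) - (fderiv ℝ (b t) (c t) * M t) (c' 0 - c 0) =
        fderiv ℝ (b t) (c t) (e t) +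
          (b t (c' t) - b t (c t) - fderiv ℝ (b t) (c t) (c' t - c t)) := by
      simp only [he, map_sub, mul_apply_eq_comp]
      abel
    rw [e1]
    refine (norm_add_le _ _).trans (add_le_add ?_ (hbr t ht'))
    exact ((fderiv ℝ (b t) (c t)).le_opNorm _).trans
      (mul_le_mul_of_nonneg_right (hC t ht' _ (h.mem_closedBall ht')).2 (norm_nonneg _))

end Flow

/-! ### Law of the solution of a differential equation with random initial value -/

/-- The measure with density `ρ` with respect to Lebesgue measure. -/
def densityMeasure (ρ : Space d → ℝ) : Measure (Space d) :=
  volume.withDensity fun x => ENNReal.ofReal (ρ x)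

section

variable {τ : ℝ} {b : ℝ → Space d → Space d} {ρ : ℝ → Space d → ℝ}

/-- A transported density, expressed in the coordinates of the flow, is conserved. -/
theorem IsTransported.mul_det_eq (hτ : 0 ≤ τ) (h : IsTransported τ b ρ) {R : ℝ}
    {c : ℝ → Space d} (hc : IsSolution τ b R c) {M B : ℝ → Space d →L[ℝ] Space d}
    (hM0 : M 0 = 1)
    (hM : ∀ t ∈ Icc 0 τ, HasDerivWithinAt M (fderiv ℝ (b t) (c t) * M t) (Icc 0 τ) t)
    (hB : ∀ t ∈ Icc 0 τ, M t * B t = 1) :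
    ρ τ (c τ) * (M τ).det = ρ 0 (c 0) := by
  have hcont : ContinuousOn (fun t => ρ t (c t) * (M t).det) (Icc 0 τ) := by
    refine ContinuousOn.mul ?_ ?_
    · exact h.continuousOn.comp (continuousOn_id.prodMk hc.continuousOn)
        (fun s hs => ⟨hs, mem_univ _⟩)
    · exact differentiable_det.continuous.comp_continuousOn
        fun t ht => (hM t ht).continuousWithinAt
  have hderiv : ∀ t ∈ Ioo 0 τ, HasDerivAt (fun t => ρ t (c t) * (M t).det) 0 t := by
    intro t ht
    have ht' := Ioo_subset_Icc_self ht
    have hn := Icc_mem_nhds ht.1 ht.2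
    refine (h.hasDerivAt_mul_det ht ((hc.hasDerivWithinAt t ht').hasDerivAt hn)
      ((hM t ht').hasDerivAt hn) (hB t ht')).congr_deriv ?_
    -- The two parts of the derivative cancel separately: the path moves with velocity `b`, and `M`
    -- grows by the Jacobian of `b`.
    rw [mul_assoc, hB t ht', mul_one, sub_self, sub_self, map_zero]
    simp
  have := intervalIntegral.integral_eq_sub_of_hasDerivAt_of_le hτ hcont hderiv (by simp)
  simp only [intervalIntegral.integral_zero, hM0] at this
  rw [eq_comm, sub_eq_zero] at this
  rw [this]
  simp [ContinuousLinearMap.det]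

/-- The part of the initial density whose trajectories stay in a ball and end in a set `A` has at
most the mass of the final density on `A`. -/
theorem IsTransported.measure_initial_le (hτ : 0 ≤ τ) (h : IsTransported τ b ρ) (R : ℝ)
    {A : Set (Space d)} (hA : MeasurableSet A) :
    MeasurableSet {y | ∃ c, IsSolution τ b R c ∧ c 0 = y ∧ c τ ∈ A} ∧
    densityMeasure (ρ 0) {y | ∃ c, IsSolution τ b R c ∧ c 0 = y ∧ c τ ∈ A} ≤
      densityMeasure (ρ τ) A := by
  set S : Set (Space d) := {y | ∃ c, IsSolution τ b R c ∧ c 0 = y} with hS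
  have hSc : IsClosed S := isClosed_initial hτ h.field R
  have hex : ∀ y, ∃ c, y ∈ S → IsSolution τ b R c ∧ c 0 = y := fun y => by
    by_cases hy : y ∈ S
    · obtain ⟨c, hc⟩ := hy
      exact ⟨c, fun _ => hc⟩
    · exact ⟨0, fun h => absurd h hy⟩
  choose c hc using hex
  -- Differentiability is claimed only within the closed set `S`, which need not be open; this is
  -- all the change of variables requires.
  have hfund : ∀ y, ∃ M : Space d →L[ℝ] Space d, y ∈ S →
      ρ τ (c y τ) * M.det = ρ 0 y ∧ HasFDerivWithinAt (fun y => c y τ) M S y := by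
    intro y
    by_cases hy : y ∈ S
    swap
    · exact ⟨0, fun h => absurd h hy⟩
    obtain ⟨hcy, hcy0⟩ := hc y hy
    obtain ⟨M, B, hM0, hM, hB⟩ := exists_fundamental_solution hτ
      (A := fun t => fderiv ℝ (b t) (c y t))
      (h.field.fderiv_continuousOn.comp (continuousOn_id.prodMk hcy.continuousOn)
        (fun s hs => ⟨hs, mem_univ _⟩))
    refine ⟨M τ, fun _ => ⟨?_, ?_⟩⟩
    · rw [h.mul_det_eq hτ hcy hM0 hM hB, hcy0]
    · rw [hasFDerivWithinAt_iff_isLittleO, Asymptotics.isLittleO_iff]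
      intro ε hε
      obtain ⟨δ, hδ, hδ'⟩ := hcy.exists_linearization hτ h.field hM0 hM hε
      filter_upwards [inter_mem_nhdsWithin S (Metric.ball_mem_nhds y hδ)] with y' hy'
      obtain ⟨hcy', hcy0'⟩ := hc y' hy'.1
      have := hδ' (c y') hcy' (by rw [hcy0', hcy0]; exact hy'.2)
      rwa [hcy0', hcy0] at this
  choose M hM using hfund
  set Z : Space d → Space d := fun y => c y τ with hZ
  have hZc : ContinuousOn Z S := fun y hy => (hM y hy).2.continuousWithinAt
  have hinj : InjOn Z S := by
    intro y hy y' hy' he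
    have := IsSolution.initial_eq_of_eq hτ h.field (hc y hy).1 (hc y' hy').1 he
    rwa [(hc y hy).2, (hc y' hy').2] at this
  have hW : {y | ∃ c, IsSolution τ b R c ∧ c 0 = y ∧ c τ ∈ A} = S ∩ Z ⁻¹' A := by
    ext y
    constructor
    · rintro ⟨e, he, he0, heA⟩
      have hy : y ∈ S := ⟨e, he, he0⟩
      refine ⟨hy, ?_⟩
      have := IsSolution.eq_of_initial_eq h.field he (hc y hy).1 (by rw [he0, (hc y hy).2])
        (right_mem_Icc.2 hτ)
      rw [mem_preimage, hZ]
      simpa only [← this] using heA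
    · rintro ⟨hy, hyA⟩
      exact ⟨c y, (hc y hy).1, (hc y hy).2, hyA⟩
  have hWm : MeasurableSet (S ∩ Z ⁻¹' A) := by
    have h1 : Measurable (S.domRestrict Z) := hZc.domRestrict.measurable
    have h2 := (MeasurableEmbedding.subtype_coe hSc.measurableSet).measurableSet_image.2 (h1 hA)
    convert h2 using 1
    ext y
    exact ⟨fun hy => ⟨⟨y, hy.1⟩, hy.2, rfl⟩, fun ⟨z, hz, e⟩ => e ▸ ⟨z.2, hz⟩⟩
  rw [hW]
  refine ⟨hWm, ?_⟩
  -- Positivity of both densities forces the determinant to be positive, so the absolute value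
  -- disappears.
  have hdet : ∀ y ∈ S, ENNReal.ofReal |(M y).det| * ENNReal.ofReal (ρ τ (Z y)) =
      ENNReal.ofReal (ρ 0 y) := by
    intro y hy
    have h1 := h.pos τ (right_mem_Icc.2 hτ) (Z y)
    have h2 := h.pos 0 (left_mem_Icc.2 hτ) y
    have h3 := (hM y hy).1
    rw [← ENNReal.ofReal_mul (abs_nonneg _), ← h3, mul_comm, abs_of_pos]
    rw [← h3] at h2
    exact pos_of_mul_pos_right h2 h1.le
  rw [densityMeasure, densityMeasure, withDensity_apply _ hWm, withDensity_apply _ hA]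
  calc ∫⁻ y in S ∩ Z ⁻¹' A, ENNReal.ofReal (ρ 0 y)
      = ∫⁻ y in S ∩ Z ⁻¹' A, ENNReal.ofReal |(M y).det| * ENNReal.ofReal (ρ τ (Z y)) :=
        setLIntegral_congr_fun hWm fun y hy => (hdet y hy.1).symm
    _ = ∫⁻ x in Z '' (S ∩ Z ⁻¹' A), ENNReal.ofReal (ρ τ x) :=
        (lintegral_image_eq_lintegral_abs_det_fderiv_mul volume hWm
          (fun y hy => (hM y hy.1).2.mono inter_subset_left) (hinj.mono inter_subset_left)
          fun x => ENNReal.ofReal (ρ τ x)).symm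
    _ ≤ ∫⁻ x in A, ENNReal.ofReal (ρ τ x) :=
        lintegral_mono_set (by rintro _ ⟨y, hy, rfl⟩; exact hy.2)

/-- If the density `ρ` is transported by `b` and `Y` solves `Y' = b(t, Y)` with initial density
`ρ 0`, then the final density of `Y` is `ρ τ`. -/
theorem IsTransported.map_eq (hτ : 0 ≤ τ) (h : IsTransported τ b ρ)
    (hprob : IsProbabilityMeasure (densityMeasure (ρ τ)))
    {Ω : Type*} [MeasurableSpace Ω] {P : Measure Ω} [IsProbabilityMeasure P]
    {Y : ℝ → Ω → Space d} (hY0 : HasLaw (Y 0) (densityMeasure (ρ 0)) P)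
    (hYτ : AEMeasurable (Y τ) P)
    (hode : ∀ᵐ ω ∂P, ∀ t ∈ Icc 0 τ,
      HasDerivWithinAt (fun r => Y r ω) (b t (Y t ω)) (Icc 0 τ) t) :
    P.map (Y τ) = densityMeasure (ρ τ) := by
  have := Measure.isProbabilityMeasure_map (μ := P) hYτ
  -- Both measures have mass one, so an inequality suffices and it need not be shown that every
  -- initial value has a solution.
  refine Measure.eq_of_le_of_isProbabilityMeasure (Measure.le_iff.2 fun A hA => ?_)
  set W : ℕ → Set (Space d) := fun n => {y | ∃ c, IsSolution τ b n c ∧ c 0 = y ∧ c τ ∈ A} with hW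
  have hWm : ∀ n, MeasurableSet (W n) := fun n => (h.measure_initial_le hτ n hA).1
  have hmono : Monotone W := by
    rintro m n hmn y ⟨c, hc, hc'⟩
    exact ⟨c, hc.mono (Nat.cast_le.2 hmn), hc'⟩
  -- Each path is continuous on a compact interval, hence lies in some ball of integer radius.
  have hae : Y τ ⁻¹' A ≤ᵐ[P] Y 0 ⁻¹' ⋃ n, W n := by
    filter_upwards [hode] with ω hω hA'
    have hcont : ContinuousOn (fun r => Y r ω) (Icc 0 τ) :=
      fun t ht => (hω t ht).continuousWithinAt
    obtain ⟨C, hC⟩ := isCompact_Icc.exists_bound_of_continuousOn hcont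
    obtain ⟨n, hn⟩ := exists_nat_ge C
    exact mem_iUnion.2 ⟨n, fun r => Y r ω, ⟨hω, fun t ht => (hC t ht).trans hn⟩, rfl, hA'⟩
  calc P.map (Y τ) A = P (Y τ ⁻¹' A) := Measure.map_apply_of_aemeasurable hYτ hA
    _ ≤ P (Y 0 ⁻¹' ⋃ n, W n) := measure_mono_ae hae
    _ = P.map (Y 0) (⋃ n, W n) :=
        (Measure.map_apply_of_aemeasurable hY0.aemeasurable (MeasurableSet.iUnion hWm)).symm
    _ = densityMeasure (ρ 0) (⋃ n, W n) := by rw [hY0.map_eq]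
    _ = ⨆ n, densityMeasure (ρ 0) (W n) := hmono.measure_iUnion
    _ ≤ densityMeasure (ρ τ) A := iSup_le fun n => (h.measure_initial_le hτ n hA).2

end

/-! ### Gradient, Laplacian and score in coordinates -/

/-- The standard basis vectors. -/
abbrev basisVec (i : Fin d) : Space d := EuclideanSpace.single i 1

theorem sum_smul_basisVec (x : Space d) : ∑ i, x i • basisVec i = x := by
  simpa using (EuclideanSpace.basisFun (Fin d) ℝ).sum_repr x

/-- The vector representing a linear functional. -/
def gradL (d : ℕ) : (Space d →L[ℝ] ℝ) →L[ℝ] Space d :=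
  ∑ i, (ContinuousLinearMap.apply ℝ ℝ (basisVec i : Space d)).smulRight (basisVec i : Space d)

theorem gradL_apply (l : Space d →L[ℝ] ℝ) : gradL d l = ∑ i, l (basisVec i) • basisVec i := by
  simp [gradL, sum_apply]

theorem apply_eq_sum (l : Space d →L[ℝ] ℝ) (x : Space d) :
    l x = ∑ i, x i * l (basisVec i) := by
  conv_lhs => rw [← sum_smul_basisVec x]
  simp

theorem inner_gradL (l : Space d →L[ℝ] ℝ) (x : Space d) : inner ℝ (gradL d l) x = l x := by
  rw [gradL_apply, sum_inner, apply_eq_sum]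
  refine Finset.sum_congr rfl fun i _ => ?_
  rw [inner_smul_left, EuclideanSpace.inner_single_left]
  simp [mul_comm]

theorem gradient_eq_gradL (p : Space d → ℝ) (x : Space d) :
    gradient p x = gradL d (fderiv ℝ p x) := by
  refine ext_inner_right ℝ fun y => ?_
  rw [inner_gradL, gradient, InnerProductSpace.toDual_symm_apply]

/-- The Laplacian, as the trace of the second derivative. -/
def lap (p : Space d → ℝ) (x : Space d) : ℝ :=
  ∑ i, fderiv ℝ (fderiv ℝ p) x (basisVec i) (basisVec i)

theorem laplacian_eq_lap (p : Space d → ℝ) (x : Space d) :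
    Laplacian.laplacian p x = lap p x := by
  have h := InnerProductSpace.laplacian_eq_iteratedFDeriv_orthonormalBasis p
    (EuclideanSpace.basisFun (Fin d) ℝ)
  rw [h, lap]
  refine Finset.sum_congr rfl fun i _ => ?_
  rw [iteratedFDeriv_two_apply]
  simp

theorem tr_gradL_comp (D : Space d →L[ℝ] Space d →L[ℝ] ℝ) :
    tr ((gradL d).comp D) = ∑ i, D (basisVec i) (basisVec i) := by
  rw [tr_eq_sum]
  refine Finset.sum_congr rfl fun i _ => ?_
  simp [gradL_apply, Pi.single_apply]

theorem tr_smulRight (l : Space d →L[ℝ] ℝ) (v : Space d) : tr (l.smulRight v) = l v := by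
  rw [tr_eq_sum, apply_eq_sum]
  simp [mul_comm]

theorem score_eq {q : ℝ → Space d → ℝ} {s : ℝ} {x : Space d}
    (hd : DifferentiableAt ℝ (q s) x) (hpos : 0 < q s x) :
    score q s x = (q s x)⁻¹ • gradL d (fderiv ℝ (q s) x) := by
  rw [score, gradient_eq_gradL, fderiv.log hd hpos.ne', map_smul]

theorem hasFDerivAt_score {q : ℝ → Space d → ℝ} {s : ℝ} (hq : ContDiff ℝ 2 (q s))
    (hpos : ∀ x, 0 < q s x) (x : Space d) :
    HasFDerivAt (score q s) ((q s x)⁻¹ • (gradL d).comp (fderiv ℝ (fderiv ℝ (q s)) x) +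
      ((-(q s x ^ 2)⁻¹) • fderiv ℝ (q s) x).smulRight (gradL d (fderiv ℝ (q s) x))) x := by
  have hd : Differentiable ℝ (q s) := hq.differentiable (by norm_num)
  have hd2 : Differentiable ℝ (fderiv ℝ (q s)) :=
    (hq.fderiv_right (m := 1) (by norm_num)).differentiable (by norm_num)
  have he : score q s = fun x => (q s x)⁻¹ • gradL d (fderiv ℝ (q s) x) :=
    funext fun x => score_eq (hd x) (hpos x)
  rw [he]
  have h1 : HasFDerivAt (fun x => (q s x)⁻¹) ((-(q s x ^ 2)⁻¹) • fderiv ℝ (q s) x) x :=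
    (hasDerivAt_inv (hpos x).ne').comp_hasFDerivAt x (hd x).hasFDerivAt
  exact h1.smul ((gradL d).hasFDerivAt.comp x (hd2 x).hasFDerivAt)

theorem scoreJac_eq {q : ℝ → Space d → ℝ} {s : ℝ} (hq : ContDiff ℝ 2 (q s))
    (hpos : ∀ x, 0 < q s x) (x : Space d) :
    scoreJac q s x = (q s x)⁻¹ • (gradL d).comp (fderiv ℝ (fderiv ℝ (q s)) x) +
      ((-(q s x ^ 2)⁻¹) • fderiv ℝ (q s) x).smulRight (gradL d (fderiv ℝ (q s) x)) :=
  (hasFDerivAt_score hq hpos x).fderiv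

/-- `div (q ∇ log q) = Δ q`. -/
theorem mul_tr_scoreJac_add {q : ℝ → Space d → ℝ} {s : ℝ} (hq : ContDiff ℝ 2 (q s))
    (hpos : ∀ x, 0 < q s x) (x : Space d) :
    q s x * tr (scoreJac q s x) + fderiv ℝ (q s) x (score q s x) = lap (q s) x := by
  rw [scoreJac_eq hq hpos, score_eq (hq.differentiable (by norm_num) x) (hpos x), tr_add, tr_smul,
    tr_gradL_comp, tr_smulRight, map_smul, lap]
  have := (hpos x).ne'
  simp only [smul_apply, smul_eq_mul]
  field_simp
  ring

/-! ### Integration by parts against test functions -/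

theorem integral_mul_fderiv_test {p φ : Space d → ℝ} (hp : ContDiff ℝ 1 p) (hφ : ContDiff ℝ 1 φ)
    (hc : HasCompactSupport φ) (v : Space d) :
    ∫ x, p x * fderiv ℝ φ x v = -∫ x, fderiv ℝ p x v * φ x := by
  have hp' : Continuous fun x => fderiv ℝ p x v :=
    (hp.continuous_fderiv one_ne_zero).clm_apply continuous_const
  have hφ' : Continuous fun x => fderiv ℝ φ x v :=
    (hφ.continuous_fderiv one_ne_zero).clm_apply continuous_const
  refine integral_mul_fderiv_eq_neg_fderiv_mul_of_integrable ?_ ?_ ?_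
    (fun x _ => hp.differentiable one_ne_zero x) (fun x _ => hφ.differentiable one_ne_zero x)
  · exact (hp'.mul hφ.continuous).integrable_of_hasCompactSupport hc.mul_left
  · exact (hp.continuous.mul hφ').integrable_of_hasCompactSupport (hc.fderiv_apply ℝ v).mul_left
  · exact (hp.continuous.mul hφ.continuous).integrable_of_hasCompactSupport hc.mul_left

/-- The product rule for `div (p v)`, in the coordinates used for the integration by parts. -/
theorem tr_fderiv_mul_add {p : Space d → ℝ} {v : Space d → Space d} {x : Space d}
    (hp : DifferentiableAt ℝ p x) (hv : DifferentiableAt ℝ v x) :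
    ∑ i, fderiv ℝ (fun y => v y i * p y) x (basisVec i) =
      p x * tr (fderiv ℝ v x) + fderiv ℝ p x (v x) := by
  have h : ∀ i, HasFDerivAt (fun y => v y i)
      ((EuclideanSpace.proj i : Space d →L[ℝ] ℝ).comp (fderiv ℝ v x)) x := fun i =>
    (EuclideanSpace.proj i : Space d →L[ℝ] ℝ).hasFDerivAt.comp x hv.hasFDerivAt
  rw [tr_eq_sum, apply_eq_sum, Finset.mul_sum, ← Finset.sum_add_distrib]
  refine Finset.sum_congr rfl fun i _ => ?_
  rw [((h i).fun_mul hp.hasFDerivAt).fderiv]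
  simp
  ring

/-- The adjoint of `φ ↦ ∇φ · v + c Δφ`. -/
def adjointGenerator (v : Space d → Space d) (c : ℝ) (p : Space d → ℝ) (x : Space d) : ℝ :=
  -(p x * tr (fderiv ℝ v x) + fderiv ℝ p x (v x)) + c * lap p x

/-- In each coordinate, one integration by parts for the drift and two for the Laplacian. Compact
support of `φ` removes the boundary terms, so `p` needs no decay. -/
theorem integral_generator_mul {v : Space d → Space d} (c : ℝ) {p φ : Space d → ℝ}
    (hv : ContDiff ℝ 1 v) (hp : ContDiff ℝ 2 p) (hφ : ContDiff ℝ 2 φ)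
    (hc : HasCompactSupport φ) :
    ∫ x, (fderiv ℝ φ x (v x) + c * Laplacian.laplacian φ x) * p x =
      ∫ x, φ x * adjointGenerator v c p x := by
  have hp1 : ContDiff ℝ 1 p := hp.of_le (by norm_num)
  have hφ1 : ContDiff ℝ 1 φ := hφ.of_le (by norm_num)
  have hvi : ∀ i, ContDiff ℝ 1 fun x => v x i * p x := fun i =>
    ((EuclideanSpace.proj i : Space d →L[ℝ] ℝ).contDiff.comp hv).mul hp1
  have hDφ : ContDiff ℝ 1 (fderiv ℝ φ) := hφ.fderiv_right (by norm_num)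
  have hDp : ContDiff ℝ 1 (fderiv ℝ p) := hp.fderiv_right (by norm_num)
  have hDφi : ∀ i, ContDiff ℝ 1 fun x => fderiv ℝ φ x (basisVec i) := fun i =>
    hDφ.clm_apply contDiff_const
  have hDpi : ∀ i, ContDiff ℝ 1 fun x => fderiv ℝ p x (basisVec i) := fun i =>
    hDp.clm_apply contDiff_const
  have hcφi : ∀ i, HasCompactSupport fun x => fderiv ℝ φ x (basisVec i : Space d) := fun i =>
    hc.fderiv_apply ℝ _
  have hD2 : ∀ (ψ : Space d → ℝ), ContDiff ℝ 1 (fderiv ℝ ψ) → ∀ i x,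
      fderiv ℝ (fun y => fderiv ℝ ψ y (basisVec i)) x (basisVec i) =
        fderiv ℝ (fderiv ℝ ψ) x (basisVec i) (basisVec i) := by
    intro ψ hψ i x
    have := ((hψ.differentiable one_ne_zero x).hasFDerivAt.clm_apply
      (hasFDerivAt_const (basisVec i : Space d) x)).fderiv
    rw [this]
    simp
  have e1 : ∀ x, (fderiv ℝ φ x (v x) + c * Laplacian.laplacian φ x) * p x =
      ∑ i, ((v x i * p x) * fderiv ℝ φ x (basisVec i) +
        c * (p x * fderiv ℝ (fun y => fderiv ℝ φ y (basisVec i)) x (basisVec i))) := by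
    intro x
    rw [laplacian_eq_lap, lap, apply_eq_sum, Finset.sum_add_distrib, add_mul, Finset.sum_mul,
      Finset.mul_sum, Finset.sum_mul]
    congr 1
    · exact Finset.sum_congr rfl fun i _ => by ring
    · exact Finset.sum_congr rfl fun i _ => by rw [hD2 φ hDφ]; ring
  have e2 : ∀ x, φ x * adjointGenerator v c p x =
      ∑ i, (-(fderiv ℝ (fun y => v y i * p y) x (basisVec i) * φ x) +
        c * (fderiv ℝ (fun y => fderiv ℝ p y (basisVec i)) x (basisVec i) * φ x)) := by
    intro x
    rw [adjointGenerator, lap, ← tr_fderiv_mul_add (hp1.differentiable one_ne_zero x)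
      (hv.differentiable one_ne_zero x), Finset.sum_add_distrib, Finset.sum_neg_distrib,
      ← Finset.sum_mul, ← Finset.mul_sum, ← Finset.sum_mul]
    simp only [hD2 p hDp]
    ring
  simp_rw [e1, e2]
  have i1 : ∀ i, Integrable fun x => (v x i * p x) * fderiv ℝ φ x (basisVec i) := fun i =>
    ((hvi i).continuous.mul (hDφi i).continuous).integrable_of_hasCompactSupport (hcφi i).mul_left
  have i2 : ∀ i, Integrable fun x =>
      p x * fderiv ℝ (fun y => fderiv ℝ φ y (basisVec i)) x (basisVec i) := fun i =>
    (hp.continuous.mul (((hDφi i).continuous_fderiv one_ne_zero).clm_apply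
      continuous_const)).integrable_of_hasCompactSupport ((hcφi i).fderiv_apply ℝ _).mul_left
  have i3 : ∀ i, Integrable fun x =>
      fderiv ℝ (fun y => v y i * p y) x (basisVec i) * φ x := fun i =>
    ((((hvi i).continuous_fderiv one_ne_zero).clm_apply
      continuous_const).mul hφ.continuous).integrable_of_hasCompactSupport hc.mul_left
  have i4 : ∀ i, Integrable fun x =>
      fderiv ℝ (fun y => fderiv ℝ p y (basisVec i)) x (basisVec i) * φ x := fun i =>
    ((((hDpi i).continuous_fderiv one_ne_zero).clm_apply
      continuous_const).mul hφ.continuous).integrable_of_hasCompactSupport hc.mul_left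
  have i3n : ∀ i, Integrable fun x =>
      -(fderiv ℝ (fun y => v y i * p y) x (basisVec i) * φ x) := fun i => (i3 i).neg
  rw [integral_finsetSum _ fun i _ => (i1 i).fun_add ((i2 i).const_mul c),
    integral_finsetSum _ fun i _ => (i3n i).fun_add ((i4 i).const_mul c)]
  refine Finset.sum_congr rfl fun i _ => ?_
  rw [integral_add (i1 i) ((i2 i).const_mul c), integral_add (i3n i) ((i4 i).const_mul c),
    integral_const_mul, integral_const_mul, integral_neg,
    integral_mul_fderiv_test (hvi i) hφ1 hc, integral_mul_fderiv_test hp1 (hDφi i) (hcφi i)]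
  congr 2
  rw [integral_mul_fderiv_test (hDpi i) hφ1 hc, neg_neg]

/-! ### The Fokker-Planck equation -/

/-- Clamping time to `[a, b]` turns continuity on a strip into global continuity, as joint
measurability and parametric integrals want it. -/
theorem continuous_comp_projIcc {a b : ℝ} (hab : a ≤ b) {V W : Type*} [TopologicalSpace V]
    [TopologicalSpace W] {H : ℝ → V → W}
    (hH : ContinuousOn (fun p : ℝ × V => H p.1 p.2) (Icc a b ×ˢ univ)) :
    Continuous fun p : ℝ × V => H (projIcc a b hab p.1) p.2 :=
  hH.comp_continuous (f := fun p : ℝ × V => ((projIcc a b hab p.1 : ℝ), p.2)) (by fun_prop)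
    fun p => ⟨(projIcc a b hab p.1).2, mem_univ _⟩

theorem continuousOn_adjointGenerator {I : Set ℝ} {f : ℝ → Space d → Space d} {g : ℝ → ℝ}
    {q : ℝ → Space d → ℝ}
    (hf : ContinuousOn (fun p : ℝ × Space d => f p.1 p.2) (I ×ˢ univ))
    (hf' : ContinuousOn (fun p : ℝ × Space d => fderiv ℝ (f p.1) p.2) (I ×ˢ univ))
    (hg : ContinuousOn g I)
    (hq : ContinuousOn (fun p : ℝ × Space d => q p.1 p.2) (I ×ˢ univ))
    (hq' : ContinuousOn (fun p : ℝ × Space d => fderiv ℝ (q p.1) p.2) (I ×ˢ univ))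
    (hq'' : ContinuousOn (fun p : ℝ × Space d => fderiv ℝ (fderiv ℝ (q p.1)) p.2) (I ×ˢ univ)) :
    ContinuousOn (fun p : ℝ × Space d =>
      adjointGenerator (f p.1) (g p.1 ^ 2 / 2) (q p.1) p.2) (I ×ˢ univ) := by
  have hg' : ContinuousOn (fun p : ℝ × Space d => g p.1 ^ 2 / 2) (I ×ˢ univ) :=
    ((hg.comp continuousOn_fst fun p hp => hp.1).pow 2).div_const 2
  refine ((hq.mul (continuous_tr.comp_continuousOn hf')).add (hq'.clm_apply hf)).neg.add
    (hg'.mul ?_)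
  exact continuousOn_finsetSum _ fun i _ =>
    (hq''.clm_apply continuousOn_const).clm_apply continuousOn_const

section

variable {Ω : Type*} {mΩ : MeasurableSpace Ω} {P : Measure Ω} {T : ℝ}
  {f : ℝ → Space d → Space d} {g : ℝ → ℝ} {q₀ : Measure (Space d)}
  {ℱ : Filtration (Icc (0 : ℝ) T) mΩ} {X : ℝ → Ω → Space d} {q : ℝ → Space d → ℝ}

/-- The generator applied to `φ` vanishes off the support of `φ`, and `[0, T]` times that support is
compact. -/
theorem RegularCoefficients.generator_bounded (hfg : RegularCoefficients T f g)
    {φ : Space d → ℝ} (hφ : ContDiff ℝ 2 φ) (hc : HasCompactSupport φ) :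
    ContinuousOn (fun p : ℝ × Space d => generator f g p.1 φ p.2) (Icc 0 T ×ˢ univ) ∧
    ∃ C, ∀ u ∈ Icc 0 T, ∀ x, ‖generator f g u φ x‖ ≤ C := by
  have hcont : ContinuousOn (fun p : ℝ × Space d => generator f g p.1 φ p.2)
      (Icc 0 T ×ˢ univ) := by
    have hg' : ContinuousOn (fun p : ℝ × Space d => g p.1 ^ 2 / 2) (Icc 0 T ×ˢ univ) :=
      ((hfg.diffusion_continuous.comp continuousOn_fst fun p hp => hp.1).pow 2).div_const 2
    have hD : Continuous fun p : ℝ × Space d => fderiv ℝ φ p.2 :=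
      (hφ.continuous_fderiv two_ne_zero).comp continuous_snd
    have hD2 : Continuous fun p : ℝ × Space d => fderiv ℝ (fderiv ℝ φ) p.2 :=
      ((hφ.fderiv_right (m := 1) (by norm_num)).continuous_fderiv one_ne_zero).comp continuous_snd
    refine (hD.continuousOn.clm_apply hfg.drift_continuous).add (hg'.mul ?_)
    simp_rw [laplacian_eq_lap]
    exact continuousOn_finsetSum _ fun i _ =>
      (hD2.continuousOn.clm_apply continuousOn_const).clm_apply continuousOn_const
  refine ⟨hcont, ?_⟩
  obtain ⟨C, hC⟩ := (isCompact_Icc.prod hc.isCompact).exists_bound_of_continuousOn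
    (hcont.mono (prod_mono subset_rfl (subset_univ (tsupport φ))))
  refine ⟨max C 0, fun u hu x => ?_⟩
  by_cases hx : x ∈ tsupport φ
  · exact (hC (u, x) ⟨hu, hx⟩).trans (le_max_left _ _)
  · have h0 : φ =ᶠ[𝓝 x] 0 := notMem_tsupport_iff_eventuallyEq.1 hx
    have h1 : fderiv ℝ φ =ᶠ[𝓝 x] fderiv ℝ 0 := h0.fderiv
    have h2 : fderiv ℝ φ x = 0 := by
      rw [h1.self_of_nhds]; simp
    have h3 : fderiv ℝ (fderiv ℝ φ) x = 0 := by
      have : fderiv ℝ φ =ᶠ[𝓝 x] fun _ => 0 := h1.trans (Eventually.of_forall fun y => by simp)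
      rw [this.fderiv_eq]
      simp
    rw [generator, laplacian_eq_lap, lap, h2, h3]
    simp

/-- Dynkin's formula between two times, in expectation. -/
theorem IsForwardProcess.integral_test_sub [IsProbabilityMeasure P]
    (hfg : RegularCoefficients T f g)
    (hX : IsForwardProcess T f g q₀ P ℱ X) {φ : Space d → ℝ} (hφ : ContDiff ℝ (⊤ : ℕ∞) φ)
    (hc : HasCompactSupport φ) {s₁ s₂ : ℝ} (h0 : 0 ≤ s₁) (h12 : s₁ ≤ s₂) (hT : s₂ ≤ T) :
    ∫ ω, φ (X s₂ ω) ∂P - ∫ ω, φ (X s₁ ω) ∂P =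
      ∫ u in s₁..s₂, ∫ ω, generator f g u φ (X u ω) ∂P := by
  have hT0 : (0 : ℝ) ≤ T := h0.trans (h12.trans hT)
  have hφ2 : ContDiff ℝ 2 φ := contDiff_infty.1 hφ 2
  obtain ⟨hgc, C, hC⟩ := hfg.generator_bounded hφ2 hc
  have hXm : ∀ s ∈ Icc 0 T, Measurable (X s) := fun s hs =>
    ((hX.adapted ⟨s, hs⟩).mono (ℱ.le _)).measurable
  -- Continuity of paths together with measurability at each time gives the joint measurability
  -- behind Fubini.
  have hm1 : Measurable (Function.uncurry fun (u : ℝ) (ω : Ω) => X (projIcc 0 T hT0 u) ω) := by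
    refine measurable_uncurry_of_continuous_of_measurable (fun ω => ?_) fun u =>
      hXm _ (projIcc 0 T hT0 u).2
    exact (hX.continuous_paths ω).comp_continuous (by fun_prop) fun u => (projIcc 0 T hT0 u).2
  have hm : Measurable fun p : ℝ × Ω =>
      generator f g (projIcc 0 T hT0 p.1) φ (X (projIcc 0 T hT0 p.1) p.2) :=
    (continuous_comp_projIcc (H := fun u x => generator f g u φ x) hT0
      hgc).measurable.comp (measurable_fst.prodMk hm1)
  have hsub : uIoc s₁ s₂ ⊆ Icc 0 T := by
    rw [uIoc_of_le h12]
    exact fun u hu => ⟨h0.trans hu.1.le, hu.2.trans hT⟩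
  have hφX : ∀ s ∈ Icc 0 T, Integrable (fun ω => φ (X s ω)) P := by
    intro s hs
    obtain ⟨B, hB⟩ := hc.exists_bound_of_continuous hφ.continuous
    exact Integrable.of_bound (hφ.continuous.measurable.comp (hXm s hs)).aestronglyMeasurable B
      (Eventually.of_forall fun ω => hB _)
  have hii : ∀ ω, ∀ a ∈ Icc 0 T, ∀ b ∈ Icc 0 T,
      IntervalIntegrable (fun u => generator f g u φ (X u ω)) volume a b := by
    intro ω a ha b hb
    refine ContinuousOn.intervalIntegrable ?_
    have : ContinuousOn (fun u => generator f g u φ (X u ω)) (Icc 0 T) :=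
      hgc.comp (continuousOn_id.prodMk (hX.continuous_paths ω)) fun s hs => ⟨hs, mem_univ _⟩
    exact this.mono (uIcc_subset_Icc ha hb)
  have hs₁ : s₁ ∈ Icc 0 T := ⟨h0, h12.trans hT⟩
  have hs₂ : s₂ ∈ Icc 0 T := ⟨h0.trans h12, hT⟩
  have hmart := (hX.martingale φ hφ hc).setIntegral_eq (i := ⟨s₁, hs₁⟩) (j := ⟨s₂, hs₂⟩) h12
    MeasurableSet.univ
  have hint := fun i => (hX.martingale φ hφ hc).integrable i
  -- Integrability of the time integral is read off from that of the martingale.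
  have hI : ∀ s (hs : s ∈ Icc 0 T),
      Integrable (fun ω => ∫ u in (0 : ℝ)..s, generator f g u φ (X u ω)) P := by
    intro s hs
    refine ((hφX s hs).sub (hint ⟨s, hs⟩)).congr (Eventually.of_forall fun ω => ?_)
    simp
  simp only [setIntegral_univ] at hmart
  rw [integral_sub (hφX s₁ hs₁) (hI s₁ hs₁), integral_sub (hφX s₂ hs₂) (hI s₂ hs₂)] at hmart
  have hswap : ∫ u in s₁..s₂, ∫ ω, generator f g u φ (X u ω) ∂P =
      ∫ ω, (∫ u in s₁..s₂, generator f g u φ (X u ω)) ∂P := by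
    have : IsFiniteMeasure (volume.restrict (uIoc s₁ s₂)) := by
      rw [uIoc_of_le h12]
      infer_instance
    refine intervalIntegral_integral_swap ?_
    refine Integrable.of_bound (C := C) ?_ ?_
    · refine AEStronglyMeasurable.congr (f := fun p : ℝ × Ω =>
        generator f g (projIcc 0 T hT0 p.1) φ (X (projIcc 0 T hT0 p.1) p.2))
        hm.aestronglyMeasurable ?_
      have : ∀ᵐ p ∂((volume.restrict (uIoc s₁ s₂)).prod P), p.1 ∈ uIoc s₁ s₂ :=
        Measure.quasiMeasurePreserving_fst.ae (ae_restrict_mem measurableSet_uIoc)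
      filter_upwards [this] with p hp
      rw [projIcc_of_mem hT0 (hsub hp)]
      rfl
    · have : ∀ᵐ p ∂((volume.restrict (uIoc s₁ s₂)).prod P), p.1 ∈ uIoc s₁ s₂ :=
        Measure.quasiMeasurePreserving_fst.ae (ae_restrict_mem measurableSet_uIoc)
      filter_upwards [this] with p hp
      exact hC p.1 (hsub hp) _
  rw [hswap]
  have hdiff : ∀ ω, ∫ u in s₁..s₂, generator f g u φ (X u ω) =
      (∫ u in (0 : ℝ)..s₂, generator f g u φ (X u ω)) -
        ∫ u in (0 : ℝ)..s₁, generator f g u φ (X u ω) := fun ω =>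
    (intervalIntegral.integral_interval_sub_left (hii ω 0 ⟨le_rfl, hT0⟩ s₂ hs₂)
      (hii ω 0 ⟨le_rfl, hT0⟩ s₁ hs₁)).symm
  simp_rw [hdiff]
  rw [integral_sub (hI s₂ hs₂) (hI s₁ hs₁)]
  linarith

theorem IsMarginalDensity.integral_comp (hq : IsMarginalDensity T P X q) {s : ℝ}
    (hs : s ∈ Ioc 0 T) {ψ : Space d → ℝ} (hψ : Continuous ψ) :
    ∫ ω, ψ (X s ω) ∂P = ∫ x, ψ x * q s x := by
  rw [← Function.comp_def, (hq.law s hs).integral_comp hψ.aestronglyMeasurable,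
    integral_withDensity_eq_integral_toReal_smul
      (hq.contDiff s hs).continuous.measurable.ennreal_ofReal (by simp)]
  refine integral_congr_ae (Eventually.of_forall fun x => ?_)
  simp only [smul_eq_mul]
  rw [ENNReal.toReal_ofReal (hq.pos s hs x).le, mul_comm]

/-- The weak form of the Fokker-Planck equation. -/
theorem IsForwardProcess.integral_density_sub [IsProbabilityMeasure P]
    (hfg : RegularCoefficients T f g)
    (hX : IsForwardProcess T f g q₀ P ℱ X) (hq : IsMarginalDensity T P X q) {φ : Space d → ℝ}
    (hφ : ContDiff ℝ (⊤ : ℕ∞) φ) (hc : HasCompactSupport φ) {s₁ s₂ : ℝ} (h0 : 0 < s₁)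
    (h12 : s₁ ≤ s₂) (hT : s₂ ≤ T) :
    (∫ x, φ x * q s₂ x) - ∫ x, φ x * q s₁ x =
      ∫ u in s₁..s₂, ∫ x, φ x * adjointGenerator (f u) (g u ^ 2 / 2) (q u) x := by
  have hφ2 : ContDiff ℝ 2 φ := contDiff_infty.1 hφ 2
  rw [← hq.integral_comp ⟨h0, h12.trans hT⟩ hφ.continuous,
    ← hq.integral_comp ⟨h0.trans_le h12, hT⟩ hφ.continuous,
    hX.integral_test_sub hfg hφ hc h0.le h12 hT]
  refine intervalIntegral.integral_congr fun u hu => ?_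
  rw [uIcc_of_le h12] at hu
  have hu0 : u ∈ Ioc 0 T := ⟨h0.trans_le hu.1, hu.2.trans hT⟩
  have hu1 : u ∈ Icc 0 T := Ioc_subset_Icc_self hu0
  have hcont : Continuous (generator f g u φ) :=
    (hfg.generator_bounded hφ2 hc).1.comp_continuous (Continuous.prodMk_right u)
      fun x => ⟨hu1, mem_univ _⟩
  have hf1 : ContDiff ℝ 1 (f u) := contDiff_one_iff_fderiv.2
    ⟨hfg.drift_differentiable u hu1, hfg.drift_deriv_continuous.comp_continuous
      (Continuous.prodMk_right u) fun x => ⟨hu1, mem_univ _⟩⟩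
  rw [hq.integral_comp hu0 hcont]
  exact integral_generator_mul _ hf1 (hq.contDiff u hu0) hφ2 hc

/-- The integrated pointwise form of the Fokker-Planck equation. -/
theorem IsForwardProcess.density_sub [IsProbabilityMeasure P] (hfg : RegularCoefficients T f g)
    (hX : IsForwardProcess T f g q₀ P ℱ X) (hq : IsMarginalDensity T P X q) {s₁ s₂ : ℝ}
    (h0 : 0 < s₁) (h12 : s₁ ≤ s₂) (hT : s₂ ≤ T) (x : Space d) :
    q s₂ x - q s₁ x = ∫ u in s₁..s₂, adjointGenerator (f u) (g u ^ 2 / 2) (q u) x := by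
  set G : ℝ → Space d → ℝ := fun u x => adjointGenerator (f u) (g u ^ 2 / 2) (q u) x with hG
  have hI0 : Icc s₁ s₂ ⊆ Icc 0 T := Icc_subset_Icc h0.le hT
  have hI : Icc s₁ s₂ ⊆ Ioc 0 T := fun u hu => ⟨h0.trans_le hu.1, hu.2.trans hT⟩
  have hI0' := prod_mono hI0 (Subset.refl (univ : Set (Space d)))
  have hI' := prod_mono hI (Subset.refl (univ : Set (Space d)))
  have hGc : ContinuousOn (fun p : ℝ × Space d => G p.1 p.2) (Icc s₁ s₂ ×ˢ univ) :=
    continuousOn_adjointGenerator (hfg.drift_continuous.mono hI0')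
      (hfg.drift_deriv_continuous.mono hI0') (hfg.diffusion_continuous.mono hI0)
      (hq.continuous.mono hI') (hq.deriv_continuous.mono hI') (hq.deriv_two_continuous.mono hI')
  have hGc' := continuous_comp_projIcc h12 hGc
  have hGproj : ∀ x, ∫ u in s₁..s₂, G u x = ∫ u in s₁..s₂, G (projIcc s₁ s₂ h12 u) x := by
    intro x
    refine intervalIntegral.integral_congr fun u hu => ?_
    rw [uIcc_of_le h12] at hu
    rw [projIcc_of_mem h12 hu]
  have hintc : Continuous fun x => ∫ u in s₁..s₂, G u x := by
    simp_rw [hGproj]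
    exact intervalIntegral.continuous_parametric_intervalIntegral_of_continuous'
      (f := fun x u => G (projIcc s₁ s₂ h12 u) x) (hGc'.comp continuous_swap) s₁ s₂
  have hs₁ : s₁ ∈ Ioc 0 T := ⟨h0, h12.trans hT⟩
  have hs₂ : s₂ ∈ Ioc 0 T := ⟨h0.trans_le h12, hT⟩
  have hdc : Continuous fun x => q s₂ x - q s₁ x :=
    (hq.contDiff s₂ hs₂).continuous.sub (hq.contDiff s₁ hs₁).continuous
  -- Both sides are continuous in `x`; agreement against all test functions gives equality almost
  -- everywhere, hence everywhere.
  have hae := ae_eq_of_integral_contDiff_smul_eq (μ := (volume : Measure (Space d)))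
    hdc.locallyIntegrable hintc.locallyIntegrable (fun φ hφ hc => ?_)
  · have := (hdc.ae_eq_iff_eq volume hintc).1 hae
    exact congrFun this x
  simp only [smul_eq_mul, mul_sub]
  have hφq : ∀ s ∈ Ioc 0 T, Integrable fun x => φ x * q s x := fun s hs =>
    (hφ.continuous.mul (hq.contDiff s hs).continuous).integrable_of_hasCompactSupport hc.mul_right
  rw [integral_sub (hφq s₂ hs₂) (hφq s₁ hs₁), hX.integral_density_sub hfg hq hφ hc h0 h12 hT]
  change ∫ u in s₁..s₂, ∫ x, φ x * G u x = _
  have h1 : ∫ u in s₁..s₂, ∫ x, φ x * G u x =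
      ∫ u in s₁..s₂, ∫ x, φ x * G (projIcc s₁ s₂ h12 u) x := by
    refine intervalIntegral.integral_congr fun u hu => ?_
    rw [uIcc_of_le h12] at hu
    rw [projIcc_of_mem h12 hu]
  have : IsFiniteMeasure (volume.restrict (uIoc s₁ s₂)) := by
    rw [uIoc_of_le h12]
    infer_instance
  rw [h1, intervalIntegral_integral_swap]
  · refine integral_congr_ae (Eventually.of_forall fun x => ?_)
    beta_reduce
    rw [hGproj, intervalIntegral.integral_const_mul]
  · obtain ⟨C, hC⟩ := (isCompact_Icc.prod hc.isCompact).exists_bound_of_continuousOn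
      (hGc.mono (prod_mono subset_rfl (subset_univ (tsupport φ))))
    have hdom : Integrable (fun p : ℝ × Space d => max C 0 * ‖φ p.2‖)
        ((volume.restrict (uIoc s₁ s₂)).prod volume) :=
      (integrable_const (max C 0)).mul_prod
        (hφ.continuous.integrable_of_hasCompactSupport hc).norm
    refine hdom.mono' ?_ (Eventually.of_forall fun p => ?_)
    · exact ((hφ.continuous.comp continuous_snd).mul hGc').aestronglyMeasurable
    · simp only [Function.uncurry]
      rw [norm_mul, mul_comm]
      by_cases hx : p.2 ∈ tsupport φ
      · refine mul_le_mul_of_nonneg_right ?_ (norm_nonneg _)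
        exact (hC (projIcc s₁ s₂ h12 p.1, p.2) ⟨(projIcc s₁ s₂ h12 p.1).2, hx⟩).trans
          (le_max_left _ _)
      · rw [image_eq_zero_of_notMem_tsupport hx]
        simp

end

/-! ### The reverse drift transports the reversed marginal densities -/

section

variable {Ω : Type*} {mΩ : MeasurableSpace Ω} {P : Measure Ω} {T δ : ℝ}
  {f : ℝ → Space d → Space d} {g : ℝ → ℝ} {q₀ : Measure (Space d)}
  {ℱ : Filtration (Icc (0 : ℝ) T) mΩ} {X : ℝ → Ω → Space d} {q : ℝ → Space d → ℝ}

theorem IsMarginalDensity.continuousOn_score (hq : IsMarginalDensity T P X q) :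
    ContinuousOn (fun p : ℝ × Space d => score q p.1 p.2) (Ioc 0 T ×ˢ univ) := by
  refine ContinuousOn.congr (f := fun p : ℝ × Space d =>
    (q p.1 p.2)⁻¹ • gradL d (fderiv ℝ (q p.1) p.2)) ?_ fun p hp =>
      score_eq ((hq.contDiff p.1 hp.1).differentiable (by norm_num) _) (hq.pos p.1 hp.1 _)
  exact (hq.continuous.inv₀ fun p hp => (hq.pos p.1 hp.1 _).ne').smul
    ((gradL d).continuous.comp_continuousOn hq.deriv_continuous)

theorem IsMarginalDensity.continuousOn_scoreJac (hq : IsMarginalDensity T P X q) :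
    ContinuousOn (fun p : ℝ × Space d => scoreJac q p.1 p.2) (Ioc 0 T ×ˢ univ) := by
  refine ContinuousOn.congr (f := fun p : ℝ × Space d =>
    (q p.1 p.2)⁻¹ • (gradL d).comp (fderiv ℝ (fderiv ℝ (q p.1)) p.2) +
      ((-(q p.1 p.2 ^ 2)⁻¹) • fderiv ℝ (q p.1) p.2).smulRight
        (gradL d (fderiv ℝ (q p.1) p.2))) ?_ fun p hp =>
      scoreJac_eq (hq.contDiff p.1 hp.1) (hq.pos p.1 hp.1) _
  have hinv := hq.continuous.inv₀ fun p hp => (hq.pos p.1 hp.1 _).ne'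
  have hinv2 := (hq.continuous.pow 2).inv₀ fun p hp => pow_ne_zero 2 (hq.pos p.1 hp.1 _).ne'
  refine (hinv.smul (continuousOn_const.clm_comp hq.deriv_two_continuous)).add ?_
  exact ((ContinuousLinearMap.smulRightL ℝ (Space d) (Space d)).continuous.comp_continuousOn
    (hinv2.neg.smul hq.deriv_continuous)).clm_apply
    ((gradL d).continuous.comp_continuousOn hq.deriv_continuous)

theorem reverseDrift_hasFDerivAt (hfg : RegularCoefficients T f g)
    (hq : IsMarginalDensity T P X q) {t : ℝ} (ht : T - t ∈ Ioc 0 T) (x : Space d) :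
    HasFDerivAt (reverseDrift T f g q t)
      (-(fderiv ℝ (f (T - t)) x - (1 / 2 * g (T - t) ^ 2) • scoreJac q (T - t) x)) x := by
  have h1 := (hfg.drift_differentiable _ (Ioc_subset_Icc_self ht) x).hasFDerivAt
  have h2 := hasFDerivAt_score (hq.contDiff _ ht) (hq.pos _ ht) x
  rw [← scoreJac_eq (hq.contDiff _ ht) (hq.pos _ ht) x] at h2
  exact (h1.sub (h2.const_smul (1 / 2 * g (T - t) ^ 2))).neg

theorem isC1Field_reverseDrift (hδ : 0 < δ) (hfg : RegularCoefficients T f g)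
    (hq : IsMarginalDensity T P X q) : IsC1Field (T - δ) (reverseDrift T f g q) := by
  have hmem : ∀ t ∈ Icc 0 (T - δ), T - t ∈ Ioc 0 T := fun t ht =>
    ⟨by linarith [ht.2], by linarith [ht.1]⟩
  have hrev : ContinuousOn (fun p : ℝ × Space d => (T - p.1, p.2)) (Icc 0 (T - δ) ×ˢ univ) := by
    fun_prop
  have hmaps : MapsTo (fun p : ℝ × Space d => (T - p.1, p.2)) (Icc 0 (T - δ) ×ˢ univ)
      (Ioc 0 T ×ˢ univ) := fun p hp => ⟨hmem p.1 hp.1, mem_univ _⟩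
  have hsub : Ioc 0 T ×ˢ (univ : Set (Space d)) ⊆ Icc 0 T ×ˢ univ :=
    prod_mono Ioc_subset_Icc_self subset_rfl
  have hg : ContinuousOn (fun p : ℝ × Space d => 1 / 2 * g (T - p.1) ^ 2)
      (Icc 0 (T - δ) ×ˢ univ) :=
    continuousOn_const.mul ((hfg.diffusion_continuous.comp (by fun_prop)
      fun p hp => Ioc_subset_Icc_self (hmem p.1 hp.1)).pow 2)
  refine ⟨fun t ht x => (reverseDrift_hasFDerivAt hfg hq (hmem t ht) x).differentiableAt, ?_, ?_⟩
  · exact (((hfg.drift_continuous.mono hsub).comp hrev hmaps).sub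
      (hg.smul (hq.continuousOn_score.comp hrev hmaps))).neg
  · refine ContinuousOn.congr (((hfg.drift_deriv_continuous.mono hsub).comp hrev hmaps).sub
      (hg.smul (hq.continuousOn_scoreJac.comp hrev hmaps))).neg fun p hp => ?_
    exact (reverseDrift_hasFDerivAt hfg hq (hmem p.1 hp.1) p.2).fderiv

/-- The fundamental theorem of calculus for the integrated equation, started at `δ` because no
density is assumed at time zero. -/
theorem IsForwardProcess.hasDerivWithinAt_density [IsProbabilityMeasure P]
    (hfg : RegularCoefficients T f g)
    (hX : IsForwardProcess T f g q₀ P ℱ X) (hq : IsMarginalDensity T P X q) (hδ : 0 < δ)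
    {s : ℝ} (hs : s ∈ Icc δ T) (x : Space d) :
    HasDerivWithinAt (fun s => q s x) (adjointGenerator (f s) (g s ^ 2 / 2) (q s) x)
      (Icc δ T) s := by
  have hI : Icc δ T ⊆ Ioc 0 T := fun u hu => ⟨hδ.trans_le hu.1, hu.2⟩
  have hI' := prod_mono hI (Subset.refl (univ : Set (Space d)))
  have hI0 := hI.trans Ioc_subset_Icc_self
  have hI0' := prod_mono hI0 (Subset.refl (univ : Set (Space d)))
  have hGc := continuousOn_adjointGenerator (hfg.drift_continuous.mono hI0')
      (hfg.drift_deriv_continuous.mono hI0') (hfg.diffusion_continuous.mono hI0)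
      (hq.continuous.mono hI') (hq.deriv_continuous.mono hI') (hq.deriv_two_continuous.mono hI')
  have hpic := ODE.hasDerivWithinAt_picard_Icc
    (f := fun u (_ : ℝ) => adjointGenerator (f u) (g u ^ 2 / 2) (q u) x) (α := fun _ => (0 : ℝ))
    (u := univ) (left_mem_Icc.2 (hs.1.trans hs.2))
    (hGc.comp (by fun_prop : ContinuousOn (fun p : ℝ × ℝ => (p.1, x)) (Icc δ T ×ˢ univ))
      fun p hp => ⟨hp.1, mem_univ _⟩) continuousOn_const (fun _ _ => mem_univ _) (q δ x) hs
  refine hpic.congr_of_mem (fun s hs => ?_) hs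
  rw [ODE.picard_apply, ← hX.density_sub hfg hq hδ hs.1 hs.2 x]
  ring

/-- The continuity equation for the reversed marginal densities. -/
theorem IsForwardProcess.isTransported [IsProbabilityMeasure P] (hδ : 0 < δ)
    (hfg : RegularCoefficients T f g)
    (hX : IsForwardProcess T f g q₀ P ℱ X) (hq : IsMarginalDensity T P X q) :
    IsTransported (T - δ) (reverseDrift T f g q) fun t => q (T - t) := by
  have hmem : ∀ t ∈ Icc 0 (T - δ), T - t ∈ Ioc 0 T := fun t ht =>
    ⟨by linarith [ht.2], by linarith [ht.1]⟩
  have hrev : ContinuousOn (fun p : ℝ × Space d => (T - p.1, p.2)) (Icc 0 (T - δ) ×ˢ univ) := by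
    fun_prop
  have hmaps : MapsTo (fun p : ℝ × Space d => (T - p.1, p.2)) (Icc 0 (T - δ) ×ˢ univ)
      (Ioc 0 T ×ˢ univ) := fun p hp => ⟨hmem p.1 hp.1, mem_univ _⟩
  refine ⟨isC1Field_reverseDrift hδ hfg hq, fun t ht => hq.pos _ (hmem t ht),
    fun t ht => (hq.contDiff _ (hmem t ht)).differentiable (by norm_num),
    hq.continuous.comp hrev hmaps, hq.deriv_continuous.comp hrev hmaps, fun x t ht => ?_⟩
  have hs : T - t ∈ Icc δ T := ⟨by linarith [ht.2], by linarith [ht.1]⟩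
  have h := (hX.hasDerivWithinAt_density hfg hq hδ hs x).scomp t
    ((hasDerivWithinAt_id t (Icc 0 (T - δ))).const_sub T)
    (fun r hr => ⟨by linarith [hr.2], by linarith [hr.1]⟩)
  refine h.congr_deriv ?_
  -- Here the Laplacian becomes the divergence of `q` times the score, so that diffusion is absorbed
  -- into the drift.
  have hlap := mul_tr_scoreJac_add (hq.contDiff _ (hmem t ht)) (hq.pos _ (hmem t ht)) x
  rw [(reverseDrift_hasFDerivAt hfg hq (hmem t ht) x).fderiv, reverseDrift, adjointGenerator,
    tr_neg, tr_sub, tr_smul, map_neg, map_sub, map_smul, ← hlap]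
  simp only [smul_eq_mul]
  ring

/-- The density of the true reverse process at time `t` is `q_{T-t}`. -/
theorem IsReverseProcess.map_eq [IsProbabilityMeasure P] (hδ : 0 < δ)
    (hfg : RegularCoefficients T f g)
    (hX : IsForwardProcess T f g q₀ P ℱ X) (hq : IsMarginalDensity T P X q)
    {Ω' : Type*} [MeasurableSpace Ω'] {P' : Measure Ω'} [IsProbabilityMeasure P']
    {Y : ℝ → Ω' → Space d} (hY : IsReverseProcess T (T - δ) f g q P' Y) {t : ℝ}
    (ht : t ∈ Icc 0 (T - δ)) :
    P'.map (Y t) = densityMeasure (q (T - t)) := by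
  have hs : T - t ∈ Ioc 0 T := ⟨by linarith [ht.2], by linarith [ht.1]⟩
  refine ((hX.isTransported hδ hfg hq).mono ht.2).map_eq ht.1
    ((hq.law _ hs).isProbabilityMeasure_iff.1 inferInstance) ?_ (hY.aemeasurable t ht) ?_
  · simp only [sub_zero]
    exact hY.initial
  · filter_upwards [hY.ode] with ω hω r hr
    exact (hω r (Icc_subset_Icc_right ht.2 hr)).mono (Icc_subset_Icc_right ht.2)

end

/-! ### Regularity of interpolation operators -/

/-- The Jacobian of the interpolation operator, as the time integral of the Jacobian of its
velocity. -/
def interpolationJac (F : ℝ → Space d → Space d) {α β : ℝ} (hαβ : α ≤ β) (t : ℝ) (x : Space d) :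
    Space d →L[ℝ] Space d :=
  1 + ∫ s in α..t, fderiv ℝ (timeDeriv F α β (projIcc α β hαβ s)) x

namespace IsInterpolation

variable {F : ℝ → Space d → Space d} {α β : ℝ}

theorem eq_add_integral (hF : IsInterpolation F α β) (hαβ : α < β) {t : ℝ} (ht : t ∈ Icc α β)
    (x : Space d) :
    F t x = x + ∫ s in α..t, timeDeriv F α β (projIcc α β hαβ.le s) x := by
  have hsub : Icc α t ⊆ Icc α β := Icc_subset_Icc_right ht.2
  have hd : ∀ s ∈ Icc α β, HasDerivWithinAt (fun s => F s x) (timeDeriv F α β s x) (Icc α β) s :=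
    fun s hs => (hF.time_differentiable x s hs).hasDerivWithinAt
  have hc : ContinuousOn (fun s => timeDeriv F α β s x) (Icc α β) :=
    hF.velocity_continuous.comp (by fun_prop : ContinuousOn (fun s : ℝ => (s, x)) (Icc α β))
      fun s hs => ⟨hs, mem_univ _⟩
  have h := intervalIntegral.integral_eq_sub_of_hasDerivAt_of_le ht.1
    (fun s hs => ((hd s (hsub hs)).continuousWithinAt.mono hsub))
    (fun s hs => (hd s (hsub (Ioo_subset_Icc_self hs))).hasDerivAt
      (Icc_mem_nhds hs.1 (hs.2.trans_le ht.2)))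
    ((hc.mono hsub).intervalIntegrable_of_Icc ht.1)
  have h2 : ∫ s in α..t, timeDeriv F α β (projIcc α β hαβ.le s) x =
      ∫ s in α..t, timeDeriv F α β s x := by
    refine intervalIntegral.integral_congr fun s hs => ?_
    rw [uIcc_of_le ht.1] at hs
    rw [projIcc_of_mem hαβ.le (hsub hs)]
  rw [h2, h, hF.start, add_sub_cancel]

theorem continuous_velocity (hF : IsInterpolation F α β) (hαβ : α < β) :
    Continuous fun p : ℝ × Space d => timeDeriv F α β (projIcc α β hαβ.le p.1) p.2 :=
  continuous_comp_projIcc hαβ.le hF.velocity_continuous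

theorem continuous_velocity_fderiv (hF : IsInterpolation F α β) (hαβ : α < β) :
    Continuous fun p : ℝ × Space d => fderiv ℝ (timeDeriv F α β (projIcc α β hαβ.le p.1)) p.2 :=
  continuous_comp_projIcc (H := fun t x => fderiv ℝ (timeDeriv F α β t) x) hαβ.le
    hF.velocity_deriv_continuous

theorem continuousOn (hF : IsInterpolation F α β) (hαβ : α < β) :
    ContinuousOn (fun p : ℝ × Space d => F p.1 p.2) (Icc α β ×ˢ univ) := by
  have h : Continuous fun p : ℝ × Space d => p.2 +
      ∫ s in α..p.1, timeDeriv F α β (projIcc α β hαβ.le s) p.2 :=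
    continuous_snd.add (intervalIntegral.continuous_parametric_intervalIntegral_of_continuous
      (f := fun (p : ℝ × Space d) s => timeDeriv F α β (projIcc α β hαβ.le s) p.2)
      ((hF.continuous_velocity hαβ).comp
        (by fun_prop : Continuous fun p : (ℝ × Space d) × ℝ => (p.2, p.1.2))) continuous_fst)
  exact h.continuousOn.congr fun p hp => hF.eq_add_integral hαβ hp.1 p.2

theorem continuous_interpolationJac (hF : IsInterpolation F α β) (hαβ : α < β) :
    Continuous fun p : ℝ × Space d => interpolationJac F hαβ.le p.1 p.2 :=
  continuous_const.add (intervalIntegral.continuous_parametric_intervalIntegral_of_continuous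
      (f := fun (p : ℝ × Space d) s => fderiv ℝ (timeDeriv F α β (projIcc α β hαβ.le s)) p.2)
      ((hF.continuous_velocity_fderiv hαβ).comp
        (by fun_prop : Continuous fun p : (ℝ × Space d) × ℝ => (p.2, p.1.2))) continuous_fst)

/-- Spatial differentiability of `F t` is not assumed: it comes from differentiating the time
integral of the velocity under the integral sign. -/
theorem hasFDerivAt (hF : IsInterpolation F α β) (hαβ : α < β) {t : ℝ} (ht : t ∈ Icc α β)
    (x : Space d) : HasFDerivAt (F t) (interpolationJac F hαβ.le t x) x := by
  have he : F t = fun x => x + ∫ s in α..t, timeDeriv F α β (projIcc α β hαβ.le s) x :=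
    funext fun x => hF.eq_add_integral hαβ ht x
  rw [he]
  have hV := hF.continuous_velocity hαβ
  have hV' := hF.continuous_velocity_fderiv hαβ
  obtain ⟨C, hC⟩ := (isCompact_Icc.prod (isCompact_closedBall x 1)).exists_bound_of_continuousOn
    (hF.velocity_deriv_continuous.mono
      (prod_mono (Subset.refl (Icc α β)) (subset_univ (Metric.closedBall x 1))))
  have key := intervalIntegral.hasFDerivAt_integral_of_dominated_of_fderiv_le (𝕜 := ℝ)
    (μ := volume) (a := α) (b := t) (x₀ := x) (bound := fun _ => C)
    (F := fun x s => timeDeriv F α β (projIcc α β hαβ.le s) x)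
    (F' := fun x s => fderiv ℝ (timeDeriv F α β (projIcc α β hαβ.le s)) x)
    (Metric.closedBall_mem_nhds x one_pos)
    (Eventually.of_forall fun y =>
      (hV.comp (by fun_prop : Continuous fun s : ℝ => (s, y))).aestronglyMeasurable)
    ((hV.comp (by fun_prop : Continuous fun s : ℝ => (s, x))).intervalIntegrable _ _)
    (hV'.comp (by fun_prop : Continuous fun s : ℝ => (s, x))).aestronglyMeasurable
    (Eventually.of_forall fun s _ y hy =>
      hC (projIcc α β hαβ.le s, y) ⟨(projIcc α β hαβ.le s).2, hy⟩)
    intervalIntegrable_const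
    (Eventually.of_forall fun s _ y _ =>
      (hF.velocity_differentiable _ (projIcc α β hαβ.le s).2 y).hasFDerivAt)
  exact (hasFDerivAt_id x).add key

/-- Space and time derivatives commute by the construction as a time integral; the clamped integrand
makes the derivative two-sided even at the endpoints. -/
theorem hasDerivAt_interpolationJac (hF : IsInterpolation F α β) (hαβ : α < β) {t : ℝ}
    (ht : t ∈ Icc α β) (x : Space d) :
    HasDerivAt (fun s => interpolationJac F hαβ.le s x) (fderiv ℝ (timeDeriv F α β t) x) t := by
  have hc : Continuous fun s => fderiv ℝ (timeDeriv F α β (projIcc α β hαβ.le s)) x :=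
    (hF.continuous_velocity_fderiv hαβ).comp (by fun_prop : Continuous fun s : ℝ => (s, x))
  have h := (hc.integral_hasStrictDerivAt α t).hasDerivAt.const_add 1
  rwa [projIcc_of_mem hαβ.le ht] at h

theorem apply_inv (hF : IsInterpolation F α β) {t : ℝ} (ht : t ∈ Icc α β) (x : Space d) :
    F t (inv F t x) = x :=
  Function.rightInverse_invFun (hF.bijective t ht).2 x

theorem inv_apply (hF : IsInterpolation F α β) {t : ℝ} (ht : t ∈ Icc α β) (x : Space d) :
    inv F t (F t x) = x :=
  Function.leftInverse_invFun (hF.bijective t ht).1 x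

theorem interpolationJac_mul_inv (hF : IsInterpolation F α β) (hαβ : α < β) {t : ℝ}
    (ht : t ∈ Icc α β) (x : Space d) :
    interpolationJac F hαβ.le t x * fderiv ℝ (inv F t) (F t x) = 1 := by
  have h1 := (hF.inverse_differentiable t ht (F t x)).hasFDerivAt
  have h2 := hF.hasFDerivAt hαβ ht x
  have h3 : HasFDerivAt (F t ∘ inv F t)
      ((interpolationJac F hαβ.le t x).comp (fderiv ℝ (inv F t) (F t x))) (F t x) :=
    HasFDerivAt.comp _ (by rw [hF.inv_apply ht]; exact h2) h1
  have h4 : F t ∘ inv F t = id := funext fun y => hF.apply_inv ht y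
  rw [h4] at h3
  exact h3.unique (hasFDerivAt_id _)

theorem inv_mul_interpolationJac (hF : IsInterpolation F α β) (hαβ : α < β) {t : ℝ}
    (ht : t ∈ Icc α β) (x : Space d) :
    fderiv ℝ (inv F t) (F t x) * interpolationJac F hαβ.le t x = 1 := by
  have h1 := (hF.inverse_differentiable t ht (F t x)).hasFDerivAt
  have h2 := hF.hasFDerivAt hαβ ht x
  have h4 : inv F t ∘ F t = id := funext fun y => hF.inv_apply ht y
  have h3 := h1.comp x h2
  change HasFDerivAt (inv F t ∘ F t) _ x at h3
  rw [h4] at h3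
  exact h3.unique (hasFDerivAt_id _)

/-- Since inversion is continuous at units, this form yields joint continuity in time and space,
which is not assumed of the inverse map. -/
theorem fderiv_inv_eq (hF : IsInterpolation F α β) (hαβ : α < β) {t : ℝ}
    (ht : t ∈ Icc α β) (x : Space d) :
    fderiv ℝ (inv F t) (F t x) = Ring.inverse (interpolationJac F hαβ.le t x) :=
  (Ring.inverse_unit (⟨interpolationJac F hαβ.le t x, _,
    hF.interpolationJac_mul_inv hαβ ht x, hF.inv_mul_interpolationJac hαβ ht x⟩ :
      (Space d →L[ℝ] Space d)ˣ)).symm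

theorem continuousOn_fderiv_inv (hF : IsInterpolation F α β) (hαβ : α < β) :
    ContinuousOn (fun p : ℝ × Space d => fderiv ℝ (inv F p.1) (F p.1 p.2))
      (Icc α β ×ˢ univ) := by
  refine ContinuousOn.congr (f := fun p : ℝ × Space d =>
    Ring.inverse (interpolationJac F hαβ.le p.1 p.2)) (fun p hp => ?_)
    fun p hp => hF.fderiv_inv_eq hαβ hp.1 p.2
  have := NormedRing.inverse_continuousAt (⟨interpolationJac F hαβ.le p.1 p.2, _,
    hF.interpolationJac_mul_inv hαβ hp.1 p.2, hF.inv_mul_interpolationJac hαβ hp.1 p.2⟩ :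
      (Space d →L[ℝ] Space d)ˣ)
  exact (ContinuousAt.comp (f := fun p : ℝ × Space d => interpolationJac F hαβ.le p.1 p.2)
    this (hF.continuous_interpolationJac hαβ).continuousAt).continuousWithinAt

/-- The determinant is `1` at the initial time, continuous in time and never zero, so the
intermediate value theorem fixes its sign. -/
theorem det_interpolationJac_pos (hF : IsInterpolation F α β) (hαβ : α < β) {t : ℝ}
    (ht : t ∈ Icc α β) (x : Space d) : 0 < (interpolationJac F hαβ.le t x).det := by
  have hne : ∀ s ∈ Icc α β, (interpolationJac F hαβ.le s x).det ≠ 0 := by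
    intro s hs h0
    have := congrArg ContinuousLinearMap.det (hF.interpolationJac_mul_inv hαβ hs x)
    simp only [ContinuousLinearMap.det, ContinuousLinearMap.toLinearMap_mul, map_mul] at this h0
    rw [h0, zero_mul] at this
    simp at this
  have hcont : ContinuousOn (fun s => (interpolationJac F hαβ.le s x).det) (Icc α β) :=
    (differentiable_det.continuous.comp ((hF.continuous_interpolationJac hαβ).comp
      (by fun_prop : Continuous fun s : ℝ => (s, x)))).continuousOn
  have h1 : (interpolationJac F hαβ.le α x).det = 1 := by
    simp [interpolationJac, ContinuousLinearMap.det]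
  by_contra hneg
  have hmem : (0 : ℝ) ∈ Icc (interpolationJac F hαβ.le t x).det
      (interpolationJac F hαβ.le α x).det := ⟨not_lt.1 hneg, h1 ▸ zero_le_one⟩
  obtain ⟨s, hs, hs0⟩ := intermediate_value_Icc' ht.1
    (hcont.mono (Icc_subset_Icc_right ht.2)) hmem
  exact hne s ⟨hs.1, hs.2.trans ht.2⟩ hs0

theorem continuous_apply (hF : IsInterpolation F α β) (hαβ : α < β) {t : ℝ} (ht : t ∈ Icc α β) :
    Continuous (F t) :=
  continuous_iff_continuousAt.2 fun x => (hF.hasFDerivAt hαβ ht x).continuousAt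

/-- Change of variables `x = F_t(z)`. -/
theorem lintegral_preimage (hF : IsInterpolation F α β) (hαβ : α < β) {t : ℝ}
    (ht : t ∈ Icc α β) {A : Set (Space d)} (hA : MeasurableSet A) (H : Space d → ℝ≥0∞) :
    ∫⁻ x in A, H x = ∫⁻ z in F t ⁻¹' A,
      ENNReal.ofReal (interpolationJac F hαβ.le t z).det * H (F t z) := by
  have hm : MeasurableSet (F t ⁻¹' A) := (hF.continuous_apply hαβ ht).measurable hA
  conv_lhs => rw [← image_preimage_eq A (hF.bijective t ht).2]
  rw [lintegral_image_eq_lintegral_abs_det_fderiv_mul volume hm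
    (fun x _ => (hF.hasFDerivAt hαβ ht x).hasFDerivWithinAt) (hF.bijective t ht).1.injOn]
  simp_rw [abs_of_pos (hF.det_interpolationJac_pos hαβ ht _)]

end IsInterpolation

/-! ### Total variation error of one step -/

/-- `div ((û - b) ρ)` where `û = ∂F/∂t ∘ F_t⁻¹` is the velocity of the interpolation. -/
def stepDefect (b : ℝ → Space d → Space d) (ρ : ℝ → Space d → ℝ) (F : ℝ → Space d → Space d)
    (α β t : ℝ) (x : Space d) : ℝ :=
  ρ t x * (tr (fderiv ℝ (timeDeriv F α β t) (inv F t x) * fderiv ℝ (inv F t) x) -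
      tr (fderiv ℝ (b t) x)) +
    fderiv ℝ (ρ t) x (timeDeriv F α β t (inv F t x) - b t x)

section

variable {τ α β : ℝ} {b : ℝ → Space d → Space d} {ρ : ℝ → Space d → ℝ}
  {F : ℝ → Space d → Space d}

/-- At `x = F_t(z)` the inverse map enters only through its Jacobian, an inverse matrix. The
continuity serves the fundamental theorem of calculus in `t` and the measurability for Tonelli. -/
theorem IsTransported.continuousOn_stepDefect (h : IsTransported τ b ρ) (hα : 0 ≤ α)
    (hαβ : α < β) (hβ : β ≤ τ) (hF : IsInterpolation F α β) :
    ContinuousOn (fun p : ℝ × Space d => (interpolationJac F hαβ.le p.1 p.2).det *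
      stepDefect b ρ F α β p.1 (F p.1 p.2)) (Icc α β ×ˢ univ) := by
  have hmaps : MapsTo (fun p : ℝ × Space d => (p.1, F p.1 p.2)) (Icc α β ×ˢ univ)
      (Icc 0 τ ×ˢ univ) := fun p hp => ⟨⟨hα.trans hp.1.1, hp.1.2.trans hβ⟩, mem_univ _⟩
  have hFc : ContinuousOn (fun p : ℝ × Space d => (p.1, F p.1 p.2)) (Icc α β ×ˢ univ) :=
    continuousOn_fst.prodMk (hF.continuousOn hαβ)
  refine ContinuousOn.mul (differentiable_det.continuous.comp
    (hF.continuous_interpolationJac hαβ)).continuousOn ?_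
  refine ContinuousOn.congr (f := fun p : ℝ × Space d =>
    ρ p.1 (F p.1 p.2) * (tr (fderiv ℝ (timeDeriv F α β p.1) p.2 *
      fderiv ℝ (inv F p.1) (F p.1 p.2)) - tr (fderiv ℝ (b p.1) (F p.1 p.2))) +
    fderiv ℝ (ρ p.1) (F p.1 p.2) (timeDeriv F α β p.1 p.2 - b p.1 (F p.1 p.2))) ?_
    fun p hp => by simp only [stepDefect, hF.inv_apply hp.1]
  refine ((h.continuousOn.comp hFc hmaps).mul
    ((continuous_tr.comp_continuousOn (hF.velocity_deriv_continuous.mul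
      (hF.continuousOn_fderiv_inv hαβ))).sub
      (continuous_tr.comp_continuousOn (h.field.fderiv_continuousOn.comp hFc hmaps)))).add ?_
  exact (h.fderiv_continuousOn.comp hFc hmaps).clm_apply
    (hF.velocity_continuous.sub (h.field.continuousOn.comp hFc hmaps))

end

section

variable {τ α β : ℝ} {b : ℝ → Space d → Space d} {ρ : ℝ → Space d → ℝ}
  {F : ℝ → Space d → Space d}

theorem IsInterpolation.continuous_det (hF : IsInterpolation F α β) (hαβ : α < β) :
    Continuous fun p : ℝ × Space d => (interpolationJac F hαβ.le p.1 p.2).det :=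
  differentiable_det.continuous.comp (hF.continuous_interpolationJac hαβ)

/-- The pulled back density changes at the rate given by the defect. -/
theorem IsTransported.pullback_sub_le (h : IsTransported τ b ρ) (hα : 0 ≤ α)
    (hαβ : α < β) (hβ : β ≤ τ) (hF : IsInterpolation F α β) (z : Space d) :
    ‖ρ β (F β z) * (interpolationJac F hαβ.le β z).det - ρ α z‖ₑ ≤
      ∫⁻ t in Icc α β, ‖(interpolationJac F hαβ.le t z).det *
        stepDefect b ρ F α β t (F t z)‖ₑ := by
  have hsub : Icc α β ⊆ Icc 0 τ := Icc_subset_Icc hα hβ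
  have hz : ContinuousOn (fun t : ℝ => (t, z)) (Icc α β) := by fun_prop
  have hFc : ContinuousOn (fun t => F t z) (Icc α β) :=
    (hF.continuousOn hαβ).comp hz fun t ht => ⟨ht, mem_univ _⟩
  have hRc : ContinuousOn (fun t => (interpolationJac F hαβ.le t z).det *
        stepDefect b ρ F α β t (F t z)) (Icc α β) := by
    have hcomp := ContinuousOn.comp (h.continuousOn_stepDefect hα hαβ hβ hF) hz
      fun t ht => ⟨ht, mem_univ _⟩
    simpa only [Function.comp_def] using hcomp
  have hrc : ContinuousOn (fun t => ρ t (F t z) * (interpolationJac F hαβ.le t z).det)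
      (Icc α β) := by
    have h1 : ContinuousOn (fun t => ρ t (F t z)) (Icc α β) :=
      h.continuousOn.comp (continuousOn_id.prodMk hFc) fun t ht => ⟨hsub ht, mem_univ _⟩
    have h2 : Continuous fun t => (interpolationJac F hαβ.le t z).det := by
      simpa only [Function.comp_def] using (hF.continuous_det hαβ).comp
        (by fun_prop : Continuous fun t : ℝ => (t, z))
    exact h1.mul h2.continuousOn
  have hderiv : ∀ t ∈ Ioo α β, HasDerivAt
      (fun t => ρ t (F t z) * (interpolationJac F hαβ.le t z).det)
      ((interpolationJac F hαβ.le t z).det * stepDefect b ρ F α β t (F t z)) t := by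
    intro t ht
    have ht' := Ioo_subset_Icc_self ht
    have h1 : HasDerivAt (fun s => F s z) (timeDeriv F α β t z) t :=
      (hF.time_differentiable z t ht').hasDerivWithinAt.hasDerivAt (Icc_mem_nhds ht.1 ht.2)
    have := h.hasDerivAt_mul_det ⟨hα.trans_lt ht.1, ht.2.trans_le hβ⟩ h1
      (hF.hasDerivAt_interpolationJac hαβ ht' z) (hF.interpolationJac_mul_inv hαβ ht' z)
    rw [stepDefect, hF.inv_apply ht']
    exact this
  have hftc := intervalIntegral.integral_eq_sub_of_hasDerivAt_of_le hαβ.le hrc hderiv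
    (hRc.intervalIntegrable_of_Icc hαβ.le)
  have h1 : (interpolationJac F hαβ.le α z).det = 1 := by
    simp [interpolationJac, ContinuousLinearMap.det]
  rw [hF.start, h1, mul_one] at hftc
  rw [← hftc, intervalIntegral.integral_of_le hαβ.le, ← integral_Icc_eq_integral_Ioc]
  exact enorm_integral_le_lintegral_enorm _

theorem densityMeasure_real_apply {p : Space d → ℝ} (hp : Continuous p) (hpos : ∀ x, 0 < p x)
    {A : Set (Space d)} (hA : MeasurableSet A) : (densityMeasure p).real A = ∫ x in A, p x := by
  rw [Measure.real, densityMeasure, withDensity_apply _ hA,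
    integral_eq_lintegral_of_nonneg_ae (Eventually.of_forall fun x => (hpos x).le)
      hp.aestronglyMeasurable]

theorem integrable_of_isFiniteMeasure {p : Space d → ℝ} (hp : Continuous p) (hpos : ∀ x, 0 < p x)
    [IsFiniteMeasure (densityMeasure p)] : Integrable p := by
  refine ⟨hp.aestronglyMeasurable, ?_⟩
  rw [hasFiniteIntegral_iff_ofReal (Eventually.of_forall fun x => (hpos x).le)]
  have := measure_lt_top (densityMeasure p) univ
  rwa [densityMeasure, withDensity_apply _ MeasurableSet.univ, setLIntegral_univ] at this

/-- In the coordinate `z` both measures of `A` are integrals over the same preimage, of `r` and of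
`ρ α`. Their difference is at most the full `L¹` distance (the factor `1/2` is given up); Tonelli
and the change of variables at each `t` lead back to `x`. -/
theorem IsTransported.tvDist_step_le (h : IsTransported τ b ρ) (hα : 0 ≤ α)
    (hαβ : α < β) (hβ : β ≤ τ) (hF : IsInterpolation F α β)
    (hα' : IsProbabilityMeasure (densityMeasure (ρ α)))
    (hβ' : IsProbabilityMeasure (densityMeasure (ρ β))) :
    tvDist (densityMeasure (ρ β)) ((densityMeasure (ρ α)).map (F β)) ≤
      ∫⁻ t in Icc α β, ∫⁻ x, ‖stepDefect b ρ F α β t x‖ₑ := by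
  have hαI : α ∈ Icc α β := left_mem_Icc.2 hαβ.le
  have hβI : β ∈ Icc α β := right_mem_Icc.2 hαβ.le
  have hsub : Icc α β ⊆ Icc 0 τ := Icc_subset_Icc hα hβ
  have hcα := (h.differentiable α (hsub hαI)).continuous
  have hcβ := (h.differentiable β (hsub hβI)).continuous
  have hFβ := hF.continuous_apply hαβ hβI
  have hdetc : Continuous fun z => (interpolationJac F hαβ.le β z).det := by
    simpa only [Function.comp_def] using (hF.continuous_det hαβ).comp
      (by fun_prop : Continuous fun z : Space d => (β, z))
  set r : Space d → ℝ := fun z => ρ β (F β z) * (interpolationJac F hαβ.le β z).det with hr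
  have hrc : Continuous r := (hcβ.comp hFβ).mul hdetc
  have hrpos : ∀ z, 0 < r z := fun z =>
    mul_pos (h.pos β (hsub hβI) _) (hF.det_interpolationJac_pos hαβ hβI z)
  have hpull : ∀ A, MeasurableSet A →
      densityMeasure (ρ β) A = densityMeasure r (F β ⁻¹' A) := by
    intro A hA
    rw [densityMeasure, densityMeasure, withDensity_apply _ hA,
      withDensity_apply _ (hFβ.measurable hA), hF.lintegral_preimage hαβ hβI hA]
    refine setLIntegral_congr_fun (hFβ.measurable hA) fun z _ => ?_
    simp only [hr]
    rw [← ENNReal.ofReal_mul (hF.det_interpolationJac_pos hαβ hβI z).le, mul_comm]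
  -- The mass of `r` is that of `ρ β`; this gives the integrability needed to subtract the
  -- integrals.
  have hrprob : IsProbabilityMeasure (densityMeasure r) := ⟨by
    rw [← preimage_univ (f := F β), ← hpull univ MeasurableSet.univ, measure_univ]⟩
  have hri := integrable_of_isFiniteMeasure hrc hrpos
  have hαi := integrable_of_isFiniteMeasure hcα (h.pos α (hsub hαI))
  refine iSup₂_le fun A hA => ?_
  have hA' := hFβ.measurable hA
  have e1 : (densityMeasure (ρ β)).real A = ∫ z in F β ⁻¹' A, r z := by
    rw [Measure.real, hpull A hA, ← Measure.real, densityMeasure_real_apply hrc hrpos hA']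
  have e2 : ((densityMeasure (ρ α)).map (F β)).real A = ∫ z in F β ⁻¹' A, ρ α z := by
    rw [map_measureReal_apply hFβ.measurable hA,
      densityMeasure_real_apply hcα (h.pos α (hsub hαI)) hA']
  rw [e1, e2, ← integral_sub hri.integrableOn hαi.integrableOn, ← Real.enorm_eq_ofReal_abs]
  have hmeas : AEMeasurable (Function.uncurry fun (z : Space d) (t : ℝ) =>
      ‖(interpolationJac F hαβ.le t z).det * stepDefect b ρ F α β t (F t z)‖ₑ)
      ((volume : Measure (Space d)).prod (volume.restrict (Icc α β))) := by
    have hc : ContinuousOn (Function.uncurry fun (z : Space d) (t : ℝ) =>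
        (interpolationJac F hαβ.le t z).det * stepDefect b ρ F α β t (F t z))
        (univ ×ˢ Icc α β) := by
      have hcomp := ContinuousOn.comp (h.continuousOn_stepDefect hα hαβ hβ hF)
        (continuous_swap.continuousOn (s := univ ×ˢ Icc α β)) fun p hp => ⟨hp.2, mem_univ _⟩
      simpa only [Function.comp_def, Prod.fst_swap, Prod.snd_swap, Function.uncurry_def]
        using hcomp
    have hm := hc.aemeasurable (μ := (volume : Measure (Space d)).prod volume)
      (MeasurableSet.univ.prod measurableSet_Icc)
    rw [← Measure.prod_restrict, Measure.restrict_univ] at hm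
    exact hm.enorm
  calc ‖∫ z in F β ⁻¹' A, (r z - ρ α z)‖ₑ
      ≤ ∫⁻ z in F β ⁻¹' A, ‖r z - ρ α z‖ₑ := enorm_integral_le_lintegral_enorm _
    _ ≤ ∫⁻ z, ‖r z - ρ α z‖ₑ := setLIntegral_le_lintegral _ _
    _ ≤ ∫⁻ z, ∫⁻ t in Icc α β, ‖(interpolationJac F hαβ.le t z).det *
        stepDefect b ρ F α β t (F t z)‖ₑ :=
        lintegral_mono fun z => h.pullback_sub_le hα hαβ hβ hF z
    _ = ∫⁻ t in Icc α β, ∫⁻ z, ‖(interpolationJac F hαβ.le t z).det *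
        stepDefect b ρ F α β t (F t z)‖ₑ := lintegral_lintegral_swap hmeas
    _ = ∫⁻ t in Icc α β, ∫⁻ x, ‖stepDefect b ρ F α β t x‖ₑ := by
        refine setLIntegral_congr_fun measurableSet_Icc fun t ht => ?_
        have := hF.lintegral_preimage hαβ ht MeasurableSet.univ
          fun x => ‖stepDefect b ρ F α β t x‖ₑ
        rw [preimage_univ, setLIntegral_univ, setLIntegral_univ] at this
        rw [this]
        refine lintegral_congr fun z => ?_
        rw [enorm_mul, Real.enorm_eq_ofReal (hF.det_interpolationJac_pos hαβ ht z).le]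

end

/-! ### Weighted Cauchy-Schwarz inequality and densities of interpolated variables -/

/-- Hölder with exponents `2, 2` for `u √p` and `(w / p) √p`, the division being harmless where `p`
is positive and finite. -/
theorem lintegral_mul_le_weighted {V : Type*} [MeasurableSpace V] {μ : Measure V}
    {u w p : V → ℝ≥0∞} (hu : AEMeasurable u μ) (hw : AEMeasurable w μ) (hp : AEMeasurable p μ)
    (hpos : ∀ᵐ x ∂μ, 0 < p x) (hfin : ∀ᵐ x ∂μ, p x < ∞) :
    ∫⁻ x, u x * w x ∂μ ≤ (∫⁻ x, p x * u x ^ 2 ∂μ) ^ (1 / 2 : ℝ) *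
      (∫⁻ x, (w x / p x) ^ 2 * p x ∂μ) ^ (1 / 2 : ℝ) := by
  have hsq : ∀ y : ℝ≥0∞, (y ^ (1 / 2 : ℝ)) ^ 2 = y := fun y => by
    rw [← ENNReal.rpow_natCast, ← ENNReal.rpow_mul]
    norm_num
  have h := ENNReal.lintegral_mul_le_Lp_mul_Lq μ Real.HolderConjugate.two_two
    (hu.mul (hp.pow_const (1 / 2 : ℝ))) ((hw.div hp).mul (hp.pow_const (1 / 2 : ℝ)))
  refine le_trans (le_of_eq (lintegral_congr_ae ?_)) (h.trans (le_of_eq ?_))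
  · filter_upwards [hpos, hfin] with x hx hx'
    simp only [Pi.mul_apply, Pi.div_apply]
    calc u x * w x = u x * (w x / p x * p x) := by rw [ENNReal.div_mul_cancel hx.ne' hx'.ne]
      _ = u x * (w x / p x * (p x ^ (1 / 2 : ℝ)) ^ 2) := by rw [hsq]
      _ = _ := by ring
  · congr 2
    · refine lintegral_congr fun x => ?_
      simp only [Pi.mul_apply]
      rw [ENNReal.rpow_ofNat, mul_pow, hsq, mul_comm]
    · refine lintegral_congr fun x => ?_
      simp only [Pi.mul_apply, Pi.div_apply]
      rw [ENNReal.rpow_ofNat, mul_pow, hsq]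

theorem volume_absolutelyContinuous_densityMeasure {p : Space d → ℝ} (hp : Continuous p)
    (hpos : ∀ x, 0 < p x) : volume ≪ densityMeasure p :=
  withDensity_absolutelyContinuous' hp.measurable.ennreal_ofReal.aemeasurable
    (Eventually.of_forall fun x => (ENNReal.ofReal_pos.2 (hpos x)).ne')

namespace IsInterpolation

variable {F : ℝ → Space d → Space d} {α β : ℝ}

/-- Interpolation operators preserve the class of Lebesgue measure. -/
theorem map_equiv_volume (hF : IsInterpolation F α β) (hαβ : α < β) {t : ℝ} (ht : t ∈ Icc α β)
    {μ : Measure (Space d)} (h1 : μ ≪ volume) (h2 : volume ≪ μ) :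
    μ.map (F t) ≪ volume ∧ volume ≪ μ.map (F t) := by
  have hFm := (hF.continuous_apply hαβ ht).measurable
  have hdet : Continuous fun z => (interpolationJac F hαβ.le t z).det := by
    simpa only [Function.comp_def] using (hF.continuous_det hαβ).comp
      (by fun_prop : Continuous fun z : Space d => (t, z))
  have hdpos := hF.det_interpolationJac_pos hαβ ht
  -- Lebesgue measure is itself a pushforward under `F t`, of a measure with positive density, so
  -- both absolute continuities can be pushed forward.
  have hvol : (volume : Measure (Space d)) =
      (densityMeasure fun z => (interpolationJac F hαβ.le t z).det).map (F t) := by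
    ext A hA
    have := hF.lintegral_preimage hαβ ht hA fun _ => 1
    simp only [mul_one, setLIntegral_one] at this
    rw [this, Measure.map_apply hFm hA, densityMeasure, withDensity_apply _ (hFm hA)]
  constructor
  · rw [hvol]
    exact (h1.trans (volume_absolutelyContinuous_densityMeasure hdet hdpos)).map hFm
  · conv_lhs => rw [hvol]
    exact ((withDensity_absolutelyContinuous _ _).trans h2).map hFm

end IsInterpolation

/-! ### Pointwise decomposition of the defect -/

section

variable {Ω : Type*} {mΩ : MeasurableSpace Ω} {P : Measure Ω} {T δ α β t : ℝ}
  {f : ℝ → Space d → Space d} {g : ℝ → ℝ} {X : ℝ → Ω → Space d} {q : ℝ → Space d → ℝ}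
  {F : ℝ → Space d → Space d}

/-- Writing `∇q = q ∇ log q` factors out `q`. The velocity mismatch gives the two inner products,
and the divergence mismatch the three traces. -/
theorem stepDefect_eq (hfg : RegularCoefficients T f g) (hq : IsMarginalDensity T P X q)
    (hF : IsInterpolation F α β) (hαβ : α < β) (ht : t ∈ Icc α β) (hs : T - t ∈ Ioc 0 T)
    (x : Space d) :
    stepDefect (reverseDrift T f g q) (fun t => q (T - t)) F α β t x =
      q (T - t) x * (inner ℝ (Phi T f g q F α β t (inv F t x)) (score q (T - t) x) +
        tr (Psi T f g q F α β t (inv F t x)) +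
        1 / 2 * g (T - t) ^ 2 *
          inner ℝ (score q (T - α) (inv F t x) - score q (T - t) x) (score q (T - t) x) +
        1 / 2 * g (T - t) ^ 2 *
          tr (scoreJac q (T - α) (inv F t x) - scoreJac q (T - t) x) +
        tr ((jacSum T f F α β t (inv F t x)).comp
          (fderiv ℝ (inv F t) x - ContinuousLinearMap.id ℝ (Space d)))) := by
  set z := inv F t x with hz
  have hFz : F t z = x := hF.apply_inv ht x
  set c := 1 / 2 * g (T - t) ^ 2 with hc
  have hpos := hq.pos _ hs x
  have hd := (hq.contDiff _ hs).differentiable (by norm_num) x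
  have hDq : ∀ v, fderiv ℝ (q (T - t)) x v = q (T - t) x * inner ℝ v (score q (T - t) x) := by
    intro v
    rw [score_eq hd hpos, inner_smul_right, real_inner_comm, inner_gradL,
      mul_inv_cancel_left₀ hpos.ne']
  -- The frozen score at `z` is added and subtracted.
  have hvel : timeDeriv F α β t z - reverseDrift T f g q t x =
      Phi T f g q F α β t z + c • (score q (T - α) z - score q (T - t) x) := by
    rw [Phi, reverseDrift, hFz, ← hc]
    module
  have hDf := (hfg.drift_differentiable _ (Ioc_subset_Icc_self hs) x).hasFDerivAt
  have hcomp : fderiv ℝ (fun y => f (T - t) (F t y)) z =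
      fderiv ℝ (f (T - t)) x * interpolationJac F hαβ.le t z := by
    have h2 := hF.hasFDerivAt hαβ ht z
    rw [← hFz] at hDf
    have h3 : HasFDerivAt (fun y => f (T - t) (F t y)) _ z := hDf.comp z h2
    rw [h3.fderiv, hFz]
    rfl
  have hinv : interpolationJac F hαβ.le t z * fderiv ℝ (inv F t) x = 1 := by
    have := hF.interpolationJac_mul_inv hαβ ht z
    rwa [hFz] at this
  -- By the chain rule `∇_z[f(F_t z)]` times `∇F_t⁻¹` is `∇f` at `x`; the bias is exactly the cost
  -- of dropping `∇F_t⁻¹` after `jacSum`.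
  have hjac : (jacSum T f F α β t z).comp
      (fderiv ℝ (inv F t) x - ContinuousLinearMap.id ℝ (Space d)) =
      fderiv ℝ (timeDeriv F α β t) z * fderiv ℝ (inv F t) x + fderiv ℝ (f (T - t)) x -
        jacSum T f F α β t z := by
    change jacSum T f F α β t z * (fderiv ℝ (inv F t) x - 1) = _
    rw [mul_sub, mul_one]
    congr 1
    rw [jacSum, hcomp, add_mul, mul_assoc, hinv, mul_one]
  rw [stepDefect, ← hz, hDq, hvel, inner_add_left, inner_smul_left, hjac, Psi, ← hc,
    (reverseDrift_hasFDerivAt hfg hq hs x).fderiv, ← hc]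
  simp only [tr_add, tr_sub, tr_neg, tr_smul, RCLike.conj_to_real]
  ring

theorem enorm_stepDefect_le (hfg : RegularCoefficients T f g) (hq : IsMarginalDensity T P X q)
    (hF : IsInterpolation F α β) (hαβ : α < β) (ht : t ∈ Icc α β) (hs : T - t ∈ Ioc 0 T)
    (x : Space d) :
    ‖stepDefect (reverseDrift T f g q) (fun t => q (T - t)) F α β t x‖ₑ ≤
      ‖Phi T f g q F α β t (inv F t x)‖ₑ *
          (‖score q (T - t) x‖ₑ * ENNReal.ofReal (q (T - t) x)) +
        ‖tr (Psi T f g q F α β t (inv F t x))‖ₑ * ENNReal.ofReal (q (T - t) x) +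
        ENNReal.ofReal (1 / 2 * g (T - t) ^ 2) *
          (‖inner ℝ (score q (T - α) (inv F t x) - score q (T - t) x)
            (score q (T - t) x)‖ₑ * ENNReal.ofReal (q (T - t) x)) +
        ENNReal.ofReal (1 / 2 * g (T - t) ^ 2) *
          (‖tr (scoreJac q (T - α) (inv F t x) - scoreJac q (T - t) x)‖ₑ *
            ENNReal.ofReal (q (T - t) x)) +
        biasError T f F α β t * ENNReal.ofReal (q (T - t) x) := by
  rw [stepDefect_eq hfg hq hF hαβ ht hs x, enorm_mul, Real.enorm_eq_ofReal (hq.pos _ hs x).le,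
    mul_comm]
  have hc : ENNReal.ofReal (1 / 2 * g (T - t) ^ 2) = ‖1 / 2 * g (T - t) ^ 2‖ₑ :=
    (Real.enorm_eq_ofReal (by positivity)).symm
  have hbias : ‖tr ((jacSum T f F α β t (inv F t x)).comp
      (fderiv ℝ (inv F t) x - ContinuousLinearMap.id ℝ (Space d)))‖ₑ ≤ biasError T f F α β t :=
    le_iSup (fun x => ‖tr ((jacSum T f F α β t (inv F t x)).comp
      (fderiv ℝ (inv F t) x - ContinuousLinearMap.id ℝ (Space d)))‖ₑ) x
  have hinner : ‖(inner ℝ (Phi T f g q F α β t (inv F t x)) (score q (T - t) x) : ℝ)‖ₑ ≤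
      ‖Phi T f g q F α β t (inv F t x)‖ₑ * ‖score q (T - t) x‖ₑ := by
    rw [← ofReal_norm, ← ofReal_norm, ← ofReal_norm, ← ENNReal.ofReal_mul (norm_nonneg _)]
    exact ENNReal.ofReal_le_ofReal (norm_inner_le_norm _ _)
  simp only [← mul_assoc]
  rw [← add_mul, ← add_mul, ← add_mul, ← add_mul]
  gcongr
  refine (enorm_add_le _ _).trans (add_le_add ((enorm_add_le _ _).trans
    (add_le_add ((enorm_add_le _ _).trans (add_le_add ((enorm_add_le _ _).trans
      (add_le_add hinner le_rfl)) ?_)) ?_)) hbias)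
  · rw [enorm_mul, hc]
  · rw [enorm_mul, hc]

end

/-! ### The error of one step -/

/-- The weight is the density of `Z`, so the first factor becomes an expectation; `h2` makes this
density positive almost everywhere. -/
theorem lintegral_mul_le_pdf {Ω : Type*} [MeasurableSpace Ω] {P : Measure Ω} [IsFiniteMeasure P]
    {Z : Ω → Space d} (hZ : AEMeasurable Z P) (h1 : P.map Z ≪ volume) (h2 : volume ≪ P.map Z)
    {u w : Space d → ℝ≥0∞} (hu : Measurable u) (hw : Measurable w) :
    ∫⁻ x, u x * w x ≤ (∫⁻ ω, u (Z ω) ^ 2 ∂P) ^ (1 / 2 : ℝ) *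
      (∫⁻ x, (w x / pdf Z P volume x) ^ 2 * pdf Z P volume x) ^ (1 / 2 : ℝ) := by
  have : HasPDF Z P volume := (hasPDF_iff_of_aemeasurable hZ).2 ⟨inferInstance, h1⟩
  rw [← pdf.lintegral_pdf_mul (μ := volume) (X := Z) (f := fun x => u x ^ 2)
    (hu.pow_const 2).aemeasurable]
  exact lintegral_mul_le_weighted hu.aemeasurable hw.aemeasurable
    (measurable_pdf Z P volume).aemeasurable (Measure.rnDeriv_pos' h2) pdf.ae_lt_top

section

variable {Ω : Type*} {mΩ : MeasurableSpace Ω} {P : Measure Ω} {T δ α β t : ℝ}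
  {f : ℝ → Space d → Space d} {g : ℝ → ℝ} {q₀ : Measure (Space d)}
  {ℱ : Filtration (Icc (0 : ℝ) T) mΩ} {X : ℝ → Ω → Space d} {q : ℝ → Space d → ℝ}
  {F : ℝ → Space d → Space d}

theorem IsMarginalDensity.continuous_score (hq : IsMarginalDensity T P X q) {s : ℝ}
    (hs : s ∈ Ioc 0 T) : Continuous (score q s) :=
  continuous_iff_continuousAt.2 fun x =>
    (hasFDerivAt_score (hq.contDiff s hs) (hq.pos s hs) x).continuousAt

theorem IsInterpolation.continuous_inv (hF : IsInterpolation F α β) (ht : t ∈ Icc α β) :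
    Continuous (inv F t) :=
  (hF.inverse_differentiable t ht).continuous

theorem continuous_Phi (hfg : RegularCoefficients T f g) (hq : IsMarginalDensity T P X q)
    (hF : IsInterpolation F α β) (hαβ : α < β) (ht : t ∈ Icc α β) (hs : T - t ∈ Ioc 0 T)
    (hα : T - α ∈ Ioc 0 T) : Continuous (Phi T f g q F α β t) := by
  have h1 := (hF.velocity_differentiable t ht).continuous
  have h2 := (hfg.drift_differentiable _ (Ioc_subset_Icc_self hs)).continuous
  have h3 := hF.continuous_apply hαβ ht
  have h4 := hq.continuous_score hα
  unfold Phi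
  fun_prop

/-- Total derivatives are measurable in any case, so no regularity is needed here. -/
theorem measurable_Psi : Measurable (Psi T f g q F α β t) := by
  have h : Measurable (scoreJac q (T - α)) := measurable_fderiv ℝ _
  unfold Psi jacSum
  fun_prop

variable [IsProbabilityMeasure P] {Ω' : Type*} [MeasurableSpace Ω'] {P' : Measure Ω'}
  [IsProbabilityMeasure P'] {Y : ℝ → Ω' → Space d}

theorem IsReverseProcess.pdf_eq (hY : IsReverseProcess T (T - δ) f g q P' Y) (hδ : 0 < δ)
    (hfg : RegularCoefficients T f g) (hX : IsForwardProcess T f g q₀ P ℱ X)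
    (hq : IsMarginalDensity T P X q) (ht : t ∈ Icc 0 (T - δ)) :
    pdf (Y t) P' volume =ᵐ[volume] fun x => ENNReal.ofReal (q (T - t) x) := by
  rw [pdf_def, IsReverseProcess.map_eq hδ hfg hX hq hY ht]
  exact Measure.rnDeriv_withDensity _ (hq.contDiff (T - t)
    ⟨by linarith [ht.2], by linarith [ht.1]⟩).continuous.measurable.ennreal_ofReal

theorem IsReverseProcess.lintegral_stepDefect_le
    (hY : IsReverseProcess T (T - δ) f g q P' Y) (hδ : 0 < δ)
    (hfg : RegularCoefficients T f g) (hX : IsForwardProcess T f g q₀ P ℱ X)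
    (hq : IsMarginalDensity T P X q) (hF : IsInterpolation F α β) (hα : 0 ≤ α) (hαβ : α < β)
    (hβ : β ≤ T - δ) (ht : t ∈ Icc α β) :
    ∫⁻ x, ‖stepDefect (reverseDrift T f g q) (fun t => q (T - t)) F α β t x‖ₑ ≤
      scoreEstimationError P' Y T f g q F α β t + divEstimationError P' Y T f g q F α β t +
        scoreDiscretizationError T g q F α t + divDiscretizationError T g q F α t +
        biasError T f F α β t := by
  have hαI : α ∈ Icc 0 (T - δ) := ⟨hα, hαβ.le.trans hβ⟩
  have htI : t ∈ Icc 0 (T - δ) := ⟨hα.trans ht.1, ht.2.trans hβ⟩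
  have hmem : ∀ t ∈ Icc 0 (T - δ), T - t ∈ Ioc 0 T := fun t ht =>
    ⟨by linarith [ht.2], by linarith [ht.1]⟩
  have hs := hmem t htI
  have hsα := hmem α hαI
  have hcont : ∀ s ∈ Ioc 0 T, Continuous (q s) := fun s hs => (hq.contDiff s hs).continuous
  have hYm := hY.aemeasurable α hαI
  have hFc := hF.continuous_apply hαβ ht
  have hZm : AEMeasurable (fun ω => F t (Y α ω)) P' := hFc.measurable.comp_aemeasurable hYm
  have hZ : P'.map (fun ω => F t (Y α ω)) ≪ volume ∧ volume ≪ P'.map (fun ω => F t (Y α ω)) := by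
    have hmap : P'.map (fun ω => F t (Y α ω)) = (densityMeasure (q (T - α))).map (F t) := by
      rw [← IsReverseProcess.map_eq hδ hfg hX hq hY hαI,
        AEMeasurable.map_map_of_aemeasurable hFc.measurable.aemeasurable hYm]
      rfl
    rw [hmap]
    exact hF.map_equiv_volume hαβ ht (withDensity_absolutelyContinuous _ _)
      (volume_absolutelyContinuous_densityMeasure (hcont _ hsα) (hq.pos _ hsα))
  have hpdf := hY.pdf_eq hδ hfg hX hq htI
  have hinv := (hF.continuous_inv ht).measurable
  have hQ : Measurable fun x => ENNReal.ofReal (q (T - t) x) :=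
    (hcont _ hs).measurable.ennreal_ofReal
  have hS := hq.continuous_score hs
  have hSα := (hq.continuous_score hsα).measurable.comp hinv
  have hP : Measurable fun x => ‖Phi T f g q F α β t (inv F t x)‖ₑ :=
    ((continuous_Phi hfg hq hF hαβ ht hs hsα).measurable.comp hinv).enorm
  have hΨ : Measurable fun x => ‖tr (Psi T f g q F α β t (inv F t x))‖ₑ :=
    (continuous_tr.measurable.comp (measurable_Psi.comp hinv)).enorm
  have h3 : Measurable fun x => ‖(inner ℝ (score q (T - α) (inv F t x) - score q (T - t) x)
      (score q (T - t) x) : ℝ)‖ₑ :=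
    ((hSα.sub hS.measurable).inner hS.measurable).enorm
  have h4 : Measurable fun x =>
      ‖tr (scoreJac q (T - α) (inv F t x) - scoreJac q (T - t) x)‖ₑ :=
    (continuous_tr.measurable.comp (((measurable_fderiv ℝ (score q (T - α))).comp hinv).sub
      (measurable_fderiv ℝ (score q (T - t))))).enorm
  refine (lintegral_mono fun x => enorm_stepDefect_le hfg hq hF hαβ ht hs x).trans ?_
  rw [lintegral_add_left (by fun_prop), lintegral_add_left (by fun_prop),
    lintegral_add_left (by fun_prop), lintegral_add_left (by fun_prop)]
  refine add_le_add (add_le_add (add_le_add (add_le_add ?_ ?_) ?_) ?_) ?_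
  · refine (lintegral_mul_le_pdf hZm hZ.1 hZ.2 hP (hS.measurable.enorm.mul hQ)).trans_eq ?_
    -- At `x = F_t(Y α)` the point `F_t⁻¹(x)` is `Y α`, so the expectation is taken at the start of
    -- the step.
    simp only [hF.inv_apply ht]
    rw [scoreEstimationError]
    congr 2
    refine lintegral_congr_ae ?_
    filter_upwards [hpdf] with x hx
    rw [hx, Pi.mul_apply]
  · refine (lintegral_mul_le_pdf hZm hZ.1 hZ.2 hΨ hQ).trans_eq ?_
    simp only [hF.inv_apply ht]
    rw [divEstimationError]
    congr 2
    refine lintegral_congr_ae ?_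
    filter_upwards [hpdf] with x hx
    rw [hx]
  · rw [scoreDiscretizationError, lintegral_const_mul' _ _ ENNReal.ofReal_ne_top]
  · rw [divDiscretizationError, lintegral_const_mul' _ _ ENNReal.ofReal_ne_top]
  -- The bias, already bounded by its supremum, is integrated against a probability density.
  · have hone : ∫⁻ x, ENNReal.ofReal (q (T - t) x) = 1 := by
      have := Measure.isProbabilityMeasure_map (μ := P') (hY.aemeasurable t htI)
      rw [IsReverseProcess.map_eq hδ hfg hX hq hY htI] at this
      simpa [densityMeasure] using this.measure_univ
    rw [lintegral_const_mul _ hQ, hone, mul_one]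

theorem IsReverseProcess.tvDist_map_le
    (hY : IsReverseProcess T (T - δ) f g q P' Y) (hδ : 0 < δ)
    (hfg : RegularCoefficients T f g) (hX : IsForwardProcess T f g q₀ P ℱ X)
    (hq : IsMarginalDensity T P X q) (hF : IsInterpolation F α β) (hα : 0 ≤ α) (hαβ : α < β)
    (hβ : β ≤ T - δ) :
    tvDist (P'.map (Y β)) ((P'.map (Y α)).map (F β)) ≤ ∫⁻ t in Icc α β,
      (scoreEstimationError P' Y T f g q F α β t + divEstimationError P' Y T f g q F α β t +
        scoreDiscretizationError T g q F α t + divDiscretizationError T g q F α t +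
        biasError T f F α β t) := by
  have hαI : α ∈ Icc 0 (T - δ) := ⟨hα, hαβ.le.trans hβ⟩
  have hβI : β ∈ Icc 0 (T - δ) := ⟨hα.trans hαβ.le, hβ⟩
  have hprob : ∀ s ∈ Icc 0 (T - δ), IsProbabilityMeasure (densityMeasure (q (T - s))) :=
    fun s hs => by
      rw [← IsReverseProcess.map_eq hδ hfg hX hq hY hs]
      exact Measure.isProbabilityMeasure_map (hY.aemeasurable s hs)
  rw [IsReverseProcess.map_eq hδ hfg hX hq hY hαI, IsReverseProcess.map_eq hδ hfg hX hq hY hβI]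
  refine ((hX.isTransported hδ hfg hq).tvDist_step_le hα hαβ hβ hF (hprob α hαI)
    (hprob β hβI)).trans ?_
  exact setLIntegral_mono' measurableSet_Icc fun t ht =>
    hY.lintegral_stepDefect_le hδ hfg hX hq hF hα hαβ hβ ht

end

/-! ### Total variation distance -/

section

variable {V W : Type*} [MeasurableSpace V] [MeasurableSpace W]

theorem tvDist_triangle (μ ν κ : Measure V) : tvDist μ κ ≤ tvDist μ ν + tvDist ν κ := by
  refine iSup₂_le fun A hA => ?_
  calc ENNReal.ofReal |μ.real A - κ.real A|
      ≤ ENNReal.ofReal (|μ.real A - ν.real A| + |ν.real A - κ.real A|) :=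
        ENNReal.ofReal_le_ofReal (abs_sub_le _ _ _)
    _ = ENNReal.ofReal |μ.real A - ν.real A| + ENNReal.ofReal |ν.real A - κ.real A| :=
        ENNReal.ofReal_add (abs_nonneg _) (abs_nonneg _)
    _ ≤ _ := add_le_add
        (le_iSup₂ (f := fun A (_ : MeasurableSet A) => ENNReal.ofReal |μ.real A - ν.real A|) A hA)
        (le_iSup₂ (f := fun A (_ : MeasurableSet A) => ENNReal.ofReal |ν.real A - κ.real A|) A hA)

/-- Data processing inequality for deterministic maps. -/
theorem tvDist_map_le (μ ν : Measure V) {G : V → W} (hG : Measurable G) :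
    tvDist (μ.map G) (ν.map G) ≤ tvDist μ ν := by
  refine iSup₂_le fun A hA => ?_
  rw [map_measureReal_apply hG hA, map_measureReal_apply hG hA]
  exact le_iSup₂ (f := fun A (_ : MeasurableSet A) => ENNReal.ofReal |μ.real A - ν.real A|)
    _ (hG hA)

end

end DetSampler

end

/-! ### Telescoping over the steps -/

theorem theorem5p1 {d : ℕ} {T δ : ℝ} (hδ : 0 < δ)
    -- the forward process and its marginal densities
    {Ω : Type*} {mΩ : MeasurableSpace Ω} {P : Measure Ω} [IsProbabilityMeasure P]
    {f : ℝ → DetSampler.Space d → DetSampler.Space d} {g : ℝ → ℝ}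
    (hfg : DetSampler.RegularCoefficients T f g)
    {q₀ : Measure (DetSampler.Space d)} {ℱ : Filtration (Icc (0 : ℝ) T) mΩ}
    {X : ℝ → Ω → DetSampler.Space d} (hX : DetSampler.IsForwardProcess T f g q₀ P ℱ X)
    {q : ℝ → DetSampler.Space d → ℝ} (hq : DetSampler.IsMarginalDensity T P X q)
    -- the time steps `0 = t_0 < t_1 < ... < t_N = T - δ`
    {N : ℕ} {t : ℕ → ℝ} (ht_zero : t 0 = 0) (ht_lt : ∀ k < N, t k < t (k + 1))
    (ht_last : t N = T - δ)
    -- the true reverse process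
    {Ω' : Type*} [MeasurableSpace Ω'] {P' : Measure Ω'} [IsProbabilityMeasure P']
    {Y : ℝ → Ω' → DetSampler.Space d}
    (hY : DetSampler.IsReverseProcess T (T - δ) f g q P' Y)
    -- the interpolation operators and the sampling process
    {F : ℕ → ℝ → DetSampler.Space d → DetSampler.Space d}
    (hF : ∀ k < N, DetSampler.IsInterpolation (F k) (t k) (t (k + 1)))
    {π : Measure (DetSampler.Space d)}
    {Ω'' : Type*} [MeasurableSpace Ω''] {P'' : Measure Ω''} [IsProbabilityMeasure P'']
    {Yhat : ℕ → Ω'' → DetSampler.Space d}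
    (hYhat : DetSampler.IsSamplingProcess N t F π P'' Yhat) :
    DetSampler.tvDist (P'.map (Y (T - δ))) (P''.map (Yhat N)) ≤
      DetSampler.tvDist (P.map (X T)) π +
      ∑ k ∈ Finset.range N, ∫⁻ s in Icc (t k) (t (k + 1)),
        (DetSampler.scoreEstimationError P' Y T f g q (F k) (t k) (t (k + 1)) s +
          DetSampler.divEstimationError P' Y T f g q (F k) (t k) (t (k + 1)) s +
          DetSampler.scoreDiscretizationError T g q (F k) (t k) s +
          DetSampler.divDiscretizationError T g q (F k) (t k) s +
          DetSampler.biasError T f (F k) (t k) (t (k + 1)) s) := by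
  have hmono : ∀ k ≤ N, 0 ≤ t k := by
    intro k
    induction k with
    | zero => exact fun _ => ht_zero.ge
    | succ k ih => exact fun hk => (ih (by omega)).trans (ht_lt k hk).le
  have hle : ∀ k ≤ N, t k ≤ T - δ := by
    intro k hk
    induction hk using Nat.decreasingInduction with
    | self => exact ht_last.le
    | of_succ k hk ih => exact (ht_lt k hk).le.trans ih
  have hT : T ∈ Ioc 0 T := ⟨by linarith [ht_last ▸ hmono N le_rfl], le_rfl⟩
  -- Measurability is carried through the induction, since it is given only for the initial sample.
  suffices h : ∀ n ≤ N, AEMeasurable (Yhat n) P'' ∧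
      DetSampler.tvDist (P'.map (Y (t n))) (P''.map (Yhat n)) ≤
      DetSampler.tvDist (P.map (X T)) π +
      ∑ k ∈ Finset.range n, ∫⁻ s in Icc (t k) (t (k + 1)),
        (DetSampler.scoreEstimationError P' Y T f g q (F k) (t k) (t (k + 1)) s +
          DetSampler.divEstimationError P' Y T f g q (F k) (t k) (t (k + 1)) s +
          DetSampler.scoreDiscretizationError T g q (F k) (t k) s +
          DetSampler.divDiscretizationError T g q (F k) (t k) s +
          DetSampler.biasError T f (F k) (t k) (t (k + 1)) s) by
    rw [← ht_last]
    exact (h N le_rfl).2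
  intro n
  induction n with
  | zero =>
    intro _
    refine ⟨hYhat.initial.aemeasurable, ?_⟩
    rw [ht_zero, hY.initial.map_eq, hYhat.initial.map_eq, (hq.law T hT).map_eq]
    simp
  | succ k ih =>
    intro hk
    obtain ⟨hm, hb⟩ := ih (by omega)
    have hFm : Measurable (F k (t (k + 1))) :=
      ((hF k hk).continuous_apply (ht_lt k hk) (right_mem_Icc.2 (ht_lt k hk).le)).measurable
    have hstep : Yhat (k + 1) =ᵐ[P''] F k (t (k + 1)) ∘ Yhat k := hYhat.step k hk
    refine ⟨(hFm.comp_aemeasurable hm).congr hstep.symm, ?_⟩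
    have hdata := (DetSampler.tvDist_map_le (P'.map (Y (t k))) (P''.map (Yhat k)) hFm).trans hb
    rw [AEMeasurable.map_map_of_aemeasurable hFm.aemeasurable hm,
      ← Measure.map_congr hstep] at hdata
    -- The intermediate law is one sampler step started from the exact law: its distance to the
    -- exact law is the new error, and its distance to the sampler is at most the previous one.
    refine (DetSampler.tvDist_triangle _ ((P'.map (Y (t k))).map (F k (t (k + 1)))) _).trans ?_
    refine (add_le_add (hY.tvDist_map_le hδ hfg hX hq (hF k hk) (hmono k (by omega)) (ht_lt k hk)
      (hle _ hk)) hdata).trans_eq ?_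
    rw [Finset.sum_range_succ]
    exact (add_comm _ _).trans (add_assoc _ _ _)
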